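/- For $k\in\{0,1,2\}$ let $\mathbb{R}^2_k$ denote $\mathbb{R}^2$ with the flat metric $g_0=-\sum_{i=1}^k dx_i^2+\sum_{i=k+1}^2 dx_i^2$. A semi-Riemannian metric on $\mathbb{R}^2$ is a smooth symmetric $(0,2)$ tensor field that is non-degenerate at every point. The curvature of such a metric $g=\langle\cdot,\cdot\rangle$ is the function $K=\langle R(X,Y)Y,X\rangle$, where $X,Y$ is any orthonormal pair (that is, $\langle X,X\rangle=\pm1$, $\langle Y,Y\rangle=\pm1$, $\langle X,Y\rangle=0$), $R(X,Y)Z=\nabla_X\nabla_YZ-\nabla_Y\nabla_XZ-\nabla_{[X,Y]}Z$, and $\nabla$ is the Levi-Civita connection of $g$. **Theorem (Two Dimensional Rigidity).** Let $k\in\{0,1,2\}$ and let $g$ be a semi-Riemannian metric on $\mathbb{R}^2$ such that $g=g_0$ outside some compact set $C\subset\mathbb{R}^2$. Suppose that the curvature $K$ of $g$ does not change sign, i.e. either $K\ge 0$ everywhere or $K\le 0$ everywhere. Then $K\equiv 0$, and $(\mathbb{R}^2,g)$ is isometric to $\mathbb{R}^2_k=(\mathbb{R}^2,g_0)$, that is,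 there is a smooth diffeomorphism $\varphi:\mathbb{R}^2\to\mathbb{R}^2$ with $\varphi^*g_0=g$. -/

import Mathlib

open scoped Manifold ContDiff

/-- A smooth semi-Riemannian metric on the manifold `ℝⁿ`, of arbitrary signature: a smooth field
`val` of symmetric non-degenerate bilinear forms, the tangent space at each point being `ℝⁿ`. -/
structure SemiRiemannianMetric (n : ℕ) where
  val : (Fin n → ℝ) → LinearMap.BilinForm ℝ (Fin n → ℝ)
  contDiff : ∀ u v, ContDiff ℝ ∞ fun p => val p u v
  symm : ∀ p u v, val p u v = val p v u
  nondegenerate : ∀ p u, (∀ v, val p u v = 0) → u = 0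

namespace SemiRiemannianMetric

variable {n : ℕ}

/-- The form `-dx₁² - ⋯ - dx_k² + dx_{k+1}² + ⋯ + dx_n²`. -/
noncomputable def flatForm (n k : ℕ) : LinearMap.BilinForm ℝ (Fin n → ℝ) :=
  Matrix.toBilin' (Matrix.diagonal fun i : Fin n => if (i : ℕ) < k then (-1 : ℝ) else 1)

theorem flatForm_apply (n k : ℕ) (u v : Fin n → ℝ) :
    flatForm n k u v = ∑ i : Fin n, (if (i : ℕ) < k then (-1 : ℝ) else 1) * (u i * v i) := by
  rw [flatForm, Matrix.toBilin'_apply']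
  simp only [dotProduct, Matrix.mulVec_diagonal]
  exact Finset.sum_congr rfl fun i _ => by ring

/-- The standard flat metric `g₀` of index `k` (for `k ≤ n`) on `ℝⁿ`;
with it `ℝⁿ` is the space `ℝⁿ_k`. -/
noncomputable def flat (n k : ℕ) : SemiRiemannianMetric n where
  val _ := flatForm n k
  contDiff _ _ := contDiff_const
  symm _ u v := by simp only [flatForm_apply, mul_comm]
  nondegenerate _ u h := by
    funext i
    have h1 := h (Pi.single i 1)
    rw [flatForm_apply, Finset.sum_eq_single i] at h1
    · split_ifs at h1 <;> simpa using h1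
    · intro j _ hj
      simp [hj]
    · simp

/-- The matrix `(g_ij)` of the metric at `p`. -/
noncomputable def gram (g : SemiRiemannianMetric n) (p : Fin n → ℝ) : Matrix (Fin n) (Fin n) ℝ :=
  Matrix.of fun i j => g.val p (Pi.single i 1) (Pi.single j 1)

/-- The derivative at `p` in the direction `u` of `g(v, w)`, for constant vectors `u, v, w`. -/
noncomputable def dval (g : SemiRiemannianMetric n) (p u v w : Fin n → ℝ) : ℝ :=
  fderiv ℝ (fun q => g.val q v w) p u

/-- The Christoffel symbols of the first kind,
`½ (D_u g(v, w) + D_v g(u, w) - D_w g(u, v))` for constant vectors `u, v, w`. -/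
noncomputable def christoffelFirst (g : SemiRiemannianMetric n) (p u v w : Fin n → ℝ) : ℝ :=
  (1 / 2) * (g.dval p u v w + g.dval p v u w - g.dval p w u v)

/-- The Christoffel symbols `Γ(u, v)ˡ = ∑ₘ gˡᵐ Γ_m(u, v)` at `p`. -/
noncomputable def christoffel (g : SemiRiemannianMetric n) (p u v : Fin n → ℝ) : Fin n → ℝ :=
  (g.gram p)⁻¹.mulVec fun m => g.christoffelFirst p u v (Pi.single m 1)

/-- The Levi-Civita connection: `(∇_X Y)(p) = DY(p) X(p) + Γ_p(X(p), Y(p))`. -/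
noncomputable def covDeriv (g : SemiRiemannianMetric n) (X Y : (Fin n → ℝ) → (Fin n → ℝ)) :
    (Fin n → ℝ) → (Fin n → ℝ) :=
  fun p => fderiv ℝ Y p (X p) + g.christoffel p (X p) (Y p)

/-- The curvature tensor `R(X,Y)Z = ∇_X ∇_Y Z - ∇_Y ∇_X Z - ∇_[X,Y] Z`. -/
noncomputable def curvature (g : SemiRiemannianMetric n) (X Y Z : (Fin n → ℝ) → (Fin n → ℝ)) :
    (Fin n → ℝ) → (Fin n → ℝ) :=
  fun p => g.covDeriv X (g.covDeriv Y Z) p - g.covDeriv Y (g.covDeriv X Z) p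
    - g.covDeriv (VectorField.lieBracket ℝ X Y) Z p

/-- The quadrilinear form `⟨R(x,y)z,w⟩` on the tangent space at `p`; as `R` is a tensor, the
vectors may be extended to constant vector fields. -/
noncomputable def curvatureForm (g : SemiRiemannianMetric n) (p x y z w : Fin n → ℝ) : ℝ :=
  g.val p (g.curvature (fun _ => x) (fun _ => y) (fun _ => z) p) w

/-- `(x, y)` is orthonormal at `p`; unit vectors are those with `⟨x, x⟩ = ±1`. -/
def IsOrthonormalPair (g : SemiRiemannianMetric n) (p x y : Fin n → ℝ) : Prop :=
  |g.val p x x| = 1 ∧ |g.val p y y| = 1 ∧ g.val p x y = 0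

/-- The curvature `K` of a semi-Riemannian metric on `ℝ²`: the number `⟨R(x,y)y,x⟩`, where `x, y`
is any orthonormal pair (see `gaussCurvature_eq`), written in the coordinate frame `∂₁, ∂₂`. -/
noncomputable def gaussCurvature (g : SemiRiemannianMetric 2) (p : Fin 2 → ℝ) : ℝ :=
  g.curvatureForm p (Pi.single 0 1) (Pi.single 1 1) (Pi.single 1 1) (Pi.single 0 1)
    / |(g.gram p).det|

/-- `(ℝⁿ, g)` and `(ℝⁿ, h)` are isometric: there is a smooth diffeomorphism that pulls `h` back
to `g`. -/
def IsIsometricTo (g h : SemiRiemannianMetric n) : Prop :=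
  ∃ φ : Diffeomorph 𝓘(ℝ, Fin n → ℝ) 𝓘(ℝ, Fin n → ℝ) (Fin n → ℝ) (Fin n → ℝ) ∞,
    ∀ p u v, h.val (φ p) (fderiv ℝ φ p u) (fderiv ℝ φ p v) = g.val p u v

/-! The rest shows that `⟨R(x,y)y,x⟩` is the same number for all orthonormal pairs at a point. -/

theorem apply_eq_sum (L : (Fin n → ℝ) →ₗ[ℝ] ℝ) (w : Fin n → ℝ) :
    L w = ∑ j, w j * L (Pi.single j 1) := by
  conv_lhs => rw [← Finset.univ_sum_single w]
  rw [map_sum]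
  refine Finset.sum_congr rfl fun j _ => ?_
  have h2 : (Pi.single j (w j) : Fin n → ℝ) = w j • Pi.single j 1 := by
    rw [← Pi.single_smul]; simp
  rw [h2, map_smul, smul_eq_mul]

theorem val_eq_sum_left (g : SemiRiemannianMetric n) (p u v : Fin n → ℝ) :
    g.val p u v = ∑ i, u i * g.val p (Pi.single i 1) v :=
  apply_eq_sum ((g.val p).flip v) u

theorem det_gram_ne_zero (g : SemiRiemannianMetric n) (p : Fin n → ℝ) : (g.gram p).det ≠ 0 := by
  intro h
  obtain ⟨u, hu, h0⟩ := Matrix.exists_vecMul_eq_zero_iff.mpr h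
  refine hu (g.nondegenerate p u fun v => ?_)
  rw [apply_eq_sum (g.val p u) v]
  refine Finset.sum_eq_zero fun j _ => ?_
  have h1 : ∑ i, u i * g.val p (Pi.single i 1) (Pi.single j 1) = 0 := congrFun h0 j
  rw [val_eq_sum_left, h1, mul_zero]

theorem differentiable_val (g : SemiRiemannianMetric n) (v w : Fin n → ℝ) :
    Differentiable ℝ fun p => g.val p v w :=
  (g.contDiff v w).differentiable (by simp)

theorem contDiff_dval (g : SemiRiemannianMetric n) (u v w : Fin n → ℝ) :
    ContDiff ℝ ∞ fun p => g.dval p u v w :=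
  ((g.contDiff v w).fderiv_right (m := ∞) (by simp)).clm_apply contDiff_const

theorem differentiable_dval (g : SemiRiemannianMetric n) (u v w : Fin n → ℝ) :
    Differentiable ℝ fun p => g.dval p u v w :=
  (g.contDiff_dval u v w).differentiable (by simp)

theorem dval_comm (g : SemiRiemannianMetric n) (p u v w : Fin n → ℝ) :
    g.dval p u v w = g.dval p u w v := by
  simp only [dval, g.symm _ v w]

theorem dval_add_left (g : SemiRiemannianMetric n) (p a b v w : Fin n → ℝ) :
    g.dval p (a + b) v w = g.dval p a v w + g.dval p b v w := by
  simp [dval]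

theorem dval_smul_left (g : SemiRiemannianMetric n) (p : Fin n → ℝ) (c : ℝ) (a v w : Fin n → ℝ) :
    g.dval p (c • a) v w = c * g.dval p a v w := by
  simp [dval]

theorem dval_add (g : SemiRiemannianMetric n) (p u a b w : Fin n → ℝ) :
    g.dval p u (a + b) w = g.dval p u a w + g.dval p u b w := by
  simp only [dval, map_add, LinearMap.add_apply]
  rw [fderiv_fun_add (g.differentiable_val a w p) (g.differentiable_val b w p)]
  rfl

theorem dval_smul (g : SemiRiemannianMetric n) (p u : Fin n → ℝ) (c : ℝ) (a w : Fin n → ℝ) :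
    g.dval p u (c • a) w = c * g.dval p u a w := by
  simp only [dval, map_smul, LinearMap.smul_apply, smul_eq_mul]
  rw [fderiv_const_mul (g.differentiable_val a w p)]
  rfl

/-- `christoffelFirst` as a linear form in its last argument. -/
noncomputable def christoffelLin (g : SemiRiemannianMetric n) (p u v : Fin n → ℝ) :
    (Fin n → ℝ) →ₗ[ℝ] ℝ where
  toFun := g.christoffelFirst p u v
  map_add' a b := by
    simp only [christoffelFirst, g.dval_comm _ _ _ (a + b), dval_add, dval_add_left,
      g.dval_comm _ _ a, g.dval_comm _ _ b]
    ring
  map_smul' c a := by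
    simp only [christoffelFirst, g.dval_comm _ _ _ (c • a), dval_smul, dval_smul_left,
      g.dval_comm _ _ a, RingHom.id_apply, smul_eq_mul]
    ring

theorem val_christoffel (g : SemiRiemannianMetric n) (p u v w : Fin n → ℝ) :
    g.val p (g.christoffel p u v) w = g.christoffelFirst p u v w := by
  have h : (g.gram p).mulVec (g.christoffel p u v)
      = fun m => g.christoffelFirst p u v (Pi.single m 1) := by
    rw [christoffel, Matrix.mulVec_mulVec,
      Matrix.mul_nonsing_inv _ (isUnit_iff_ne_zero.mpr (g.det_gram_ne_zero p)), Matrix.one_mulVec]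
  have h2 := apply_eq_sum (g.christoffelLin p u v) w
  change g.christoffelFirst p u v w = ∑ j, w j * g.christoffelFirst p u v (Pi.single j 1) at h2
  rw [h2, apply_eq_sum (g.val p _) w]
  refine Finset.sum_congr rfl fun j _ => ?_
  rw [← congrFun h j, val_eq_sum_left, Matrix.mulVec, dotProduct]
  congr 1
  refine Finset.sum_congr rfl fun i _ => ?_
  rw [gram, Matrix.of_apply, g.symm p (Pi.single j 1), mul_comm]

theorem differentiable_det {m : ℕ} (M : (Fin n → ℝ) → Matrix (Fin m) (Fin m) ℝ)
    (hM : ∀ i j, Differentiable ℝ fun p => M p i j) : Differentiable ℝ fun p => (M p).det := by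
  simp only [Matrix.det_apply]
  refine Differentiable.fun_sum fun σ _ => Differentiable.const_smul ?_ _
  fun_prop

theorem differentiable_christoffel (g : SemiRiemannianMetric n) (u v : Fin n → ℝ) :
    Differentiable ℝ fun p => g.christoffel p u v := by
  have hG : ∀ i j, Differentiable ℝ fun p => g.gram p i j := fun i j =>
    g.differentiable_val _ _
  rw [differentiable_pi]
  intro l
  simp only [christoffel, Matrix.mulVec, dotProduct, Matrix.inv_def, Ring.inverse_eq_inv',
    Matrix.smul_apply, smul_eq_mul]
  refine Differentiable.fun_sum fun m _ => Differentiable.mul (Differentiable.mul ?_ ?_) ?_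
  · exact (differentiable_det _ hG).inv fun p => g.det_gram_ne_zero p
  · simp only [Matrix.adjugate_apply]
    refine differentiable_det _ fun i j => ?_
    by_cases h : i = m
    · subst h; simp
    · simpa [Matrix.updateRow_ne h] using hG i j
  · exact (((g.differentiable_dval _ _ _).add (g.differentiable_dval _ _ _)).sub
      (g.differentiable_dval _ _ _)).const_mul _

theorem fderiv_val_field (g : SemiRiemannianMetric n) (Y : (Fin n → ℝ) → (Fin n → ℝ))
    (hY : Differentiable ℝ Y) (p u w : Fin n → ℝ) :
    fderiv ℝ (fun q => g.val q (Y q) w) p u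
      = g.val p (fderiv ℝ Y p u) w + g.dval p u (Y p) w := by
  have hYi : ∀ i, Differentiable ℝ fun q => Y q i := fun i => differentiable_pi.mp hY i
  have h1 : (fun q => g.val q (Y q) w) = fun q => ∑ i, Y q i * g.val q (Pi.single i 1) w := by
    funext q; exact g.val_eq_sum_left q _ w
  have h2 : g.dval p u (Y p) w = ∑ i, Y p i * g.dval p u (Pi.single i 1) w := by
    let L : (Fin n → ℝ) →ₗ[ℝ] ℝ :=
      { toFun := fun a => g.dval p u a w
        map_add' := fun a b => g.dval_add p u a b w
        map_smul' := fun c a => g.dval_smul p u c a w }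
    exact apply_eq_sum L (Y p)
  have h3 : ∀ i, fderiv ℝ (fun q => Y q i) p u = fderiv ℝ Y p u i := fun i => by
    rw [fderiv_pi fun i => hYi i p]; rfl
  rw [h1, h2, val_eq_sum_left, ← Finset.sum_add_distrib,
    fderiv_fun_sum (fun i _ => (hYi i p).fun_mul (g.differentiable_val _ w p)), sum_apply]
  refine Finset.sum_congr rfl fun i _ => ?_
  rw [fderiv_fun_mul (hYi i p) (g.differentiable_val _ w p)]
  simp only [add_apply, smul_apply, smul_eq_mul, h3, dval]
  ring

theorem curvatureForm_eq (g : SemiRiemannianMetric n) (p x y z w : Fin n → ℝ) :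
    g.curvatureForm p x y z w =
      fderiv ℝ (fun q => g.christoffelFirst q y z w) p x
        - fderiv ℝ (fun q => g.christoffelFirst q x z w) p y
        - g.val p (g.christoffel p x w) (g.christoffel p y z)
        + g.val p (g.christoffel p y w) (g.christoffel p x z) := by
  have hmet : ∀ a b c, g.dval p a b c
      = g.christoffelFirst p a b c + g.christoffelFirst p a c b := fun a b c => by
    simp only [christoffelFirst]
    rw [g.dval_comm p a c b]; ring
  have hD : ∀ a b c, fderiv ℝ (fun q => g.christoffelFirst q b c w) p a
      = g.val p (fderiv ℝ (fun q => g.christoffel q b c) p a) w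
        + g.dval p a (g.christoffel p b c) w := fun a b c => by
    rw [← g.fderiv_val_field _ (g.differentiable_christoffel b c)]
    simp only [val_christoffel]
  have hb : VectorField.lieBracket ℝ (fun _ : Fin n → ℝ => x) (fun _ => y) = fun _ => 0 := by
    funext q; simp [VectorField.lieBracket]
  have hz : g.christoffel p 0 z = 0 := by
    refine g.nondegenerate p _ fun v => ?_
    rw [val_christoffel, christoffelFirst, dval, dval, dval]; simp
  have hcd : ∀ a b : Fin n → ℝ, g.covDeriv (fun _ => a) (fun _ => b)
      = fun q => g.christoffel q a b := fun a b => by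
    funext q; simp [covDeriv]
  simp only [curvatureForm, curvature, hb, hcd]
  simp only [covDeriv, hz, sub_zero, map_sub, map_add, LinearMap.sub_apply, LinearMap.add_apply,
    val_christoffel]
  rw [hD x y z, hD y x z, hmet, hmet]
  ring

/-- The second derivative at `p` in the directions `x`, `a` of `g(b, c)`. -/
noncomputable def ddval (g : SemiRiemannianMetric n) (p x a b c : Fin n → ℝ) : ℝ :=
  fderiv ℝ (fun q => g.dval q a b c) p x

theorem ddval_swap (g : SemiRiemannianMetric n) (p x a b c : Fin n → ℝ) :
    g.ddval p x a b c = g.ddval p a x b c := by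
  have hd : Differentiable ℝ (fderiv ℝ fun q => g.val q b c) :=
    ((g.contDiff b c).fderiv_right (m := ∞) (by simp)).differentiable (by simp)
  have h : ∀ u v, g.ddval p u v b c = fderiv ℝ (fderiv ℝ fun q => g.val q b c) p u v := by
    intro u v
    simp only [ddval, dval]
    rw [fderiv_clm_apply (hd p) (by fun_prop)]
    simp
  have hs : IsSymmSndFDerivAt ℝ (fun q => g.val q b c) p :=
    ((g.contDiff b c).contDiffAt).isSymmSndFDerivAt
      (by simpa using (WithTop.coe_le_coe.mpr le_top : ((2 : ℕ∞) : WithTop ℕ∞) ≤ ∞))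
  rw [h, h, hs x a]

theorem ddval_comm (g : SemiRiemannianMetric n) (p x a b c : Fin n → ℝ) :
    g.ddval p x a b c = g.ddval p x a c b := by
  simp only [ddval, g.dval_comm _ a b c]

theorem ddval_add_left (g : SemiRiemannianMetric n) (p x y a b c : Fin n → ℝ) :
    g.ddval p (x + y) a b c = g.ddval p x a b c + g.ddval p y a b c := by
  simp [ddval]

theorem ddval_smul_left (g : SemiRiemannianMetric n) (p : Fin n → ℝ) (r : ℝ)
    (x a b c : Fin n → ℝ) : g.ddval p (r • x) a b c = r * g.ddval p x a b c := by
  simp [ddval]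

theorem ddval_add (g : SemiRiemannianMetric n) (p x a b d c : Fin n → ℝ) :
    g.ddval p x a (b + d) c = g.ddval p x a b c + g.ddval p x a d c := by
  simp only [ddval, dval_add]
  rw [fderiv_fun_add (g.differentiable_dval a b c p) (g.differentiable_dval a d c p)]
  rfl

theorem ddval_smul (g : SemiRiemannianMetric n) (p : Fin n → ℝ) (r : ℝ) (x a b c : Fin n → ℝ) :
    g.ddval p x a (r • b) c = r * g.ddval p x a b c := by
  simp only [ddval, dval_smul]
  rw [fderiv_const_mul (g.differentiable_dval a b c p)]
  rfl

theorem fderiv_christoffelFirst (g : SemiRiemannianMetric n) (p x y z w : Fin n → ℝ) :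
    fderiv ℝ (fun q => g.christoffelFirst q y z w) p x
      = (1 / 2) * (g.ddval p x y z w + g.ddval p x z y w - g.ddval p x w y z) := by
  have h := fun a b c => g.differentiable_dval a b c p
  simp only [christoffelFirst, ddval]
  rw [fderiv_const_mul (((h _ _ _).fun_add (h _ _ _)).fun_sub (h _ _ _)),
    fderiv_fun_sub ((h _ _ _).fun_add (h _ _ _)) (h _ _ _), fderiv_fun_add (h _ _ _) (h _ _ _)]
  rfl

theorem christoffel_comm (g : SemiRiemannianMetric n) (p u v : Fin n → ℝ) :
    g.christoffel p u v = g.christoffel p v u := by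
  have h : ∀ w, g.christoffelFirst p u v w = g.christoffelFirst p v u w := fun w => by
    rw [christoffelFirst, christoffelFirst, g.dval_comm p w u v]; ring
  simp only [christoffel, h]

theorem christoffel_add (g : SemiRiemannianMetric n) (p u a b : Fin n → ℝ) :
    g.christoffel p u (a + b) = g.christoffel p u a + g.christoffel p u b := by
  rw [← sub_eq_zero]
  refine g.nondegenerate p _ fun w => ?_
  simp only [map_sub, map_add, LinearMap.sub_apply, LinearMap.add_apply, val_christoffel,
    christoffelFirst, dval_add, dval_add_left, g.dval_comm _ w u]
  ring

theorem christoffel_smul (g : SemiRiemannianMetric n) (p u : Fin n → ℝ) (r : ℝ)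
    (a : Fin n → ℝ) : g.christoffel p u (r • a) = r • g.christoffel p u a := by
  rw [← sub_eq_zero]
  refine g.nondegenerate p _ fun w => ?_
  simp only [map_sub, map_smul, LinearMap.sub_apply, LinearMap.smul_apply, val_christoffel,
    christoffelFirst, dval_smul, dval_smul_left, g.dval_comm _ w u, smul_eq_mul]
  ring

theorem curvatureForm_skew_left (g : SemiRiemannianMetric n) (p x y z w : Fin n → ℝ) :
    g.curvatureForm p x y z w = -g.curvatureForm p y x z w := by
  rw [curvatureForm_eq, curvatureForm_eq]; ring

theorem curvatureForm_skew_right (g : SemiRiemannianMetric n) (p x y z w : Fin n → ℝ) :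
    g.curvatureForm p x y z w = -g.curvatureForm p x y w z := by
  simp only [curvatureForm_eq, fderiv_christoffelFirst]
  rw [g.ddval_swap p y x w z, g.ddval_swap p y x z w, g.ddval_comm p x y w z,
    g.symm p (g.christoffel p y w), g.symm p (g.christoffel p x w)]
  ring

theorem curvatureForm_add_left (g : SemiRiemannianMetric n) (p a b y z w : Fin n → ℝ) :
    g.curvatureForm p (a + b) y z w = g.curvatureForm p a y z w + g.curvatureForm p b y z w := by
  simp only [curvatureForm_eq, fderiv_christoffelFirst, g.christoffel_comm p (a + b),
    g.christoffel_comm p a, g.christoffel_comm p b, christoffel_add, ddval_add_left, ddval_add,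
    g.ddval_swap p y (a + b), g.ddval_swap p y a, g.ddval_swap p y b, map_add,
    LinearMap.add_apply]
  ring

theorem curvatureForm_smul_left (g : SemiRiemannianMetric n) (p : Fin n → ℝ) (r : ℝ)
    (a y z w : Fin n → ℝ) :
    g.curvatureForm p (r • a) y z w = r * g.curvatureForm p a y z w := by
  simp only [curvatureForm_eq, fderiv_christoffelFirst, g.christoffel_comm p (r • a),
    g.christoffel_comm p a, christoffel_smul, ddval_smul_left, ddval_smul,
    g.ddval_swap p y (r • a), g.ddval_swap p y a, map_smul, LinearMap.smul_apply, smul_eq_mul]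
  ring

theorem curvatureForm_add_third (g : SemiRiemannianMetric n) (p x y a b w : Fin n → ℝ) :
    g.curvatureForm p x y (a + b) w = g.curvatureForm p x y a w + g.curvatureForm p x y b w := by
  simp only [curvatureForm_eq, fderiv_christoffelFirst, christoffel_add, ddval_add, map_add,
    g.ddval_swap p x (a + b), g.ddval_swap p x a, g.ddval_swap p x b, g.ddval_comm p _ _ y,
    g.ddval_swap p y (a + b), g.ddval_swap p y a, g.ddval_swap p y b, g.ddval_comm p _ _ x,
    ddval_add_left]
  ring

theorem curvatureForm_smul_third (g : SemiRiemannianMetric n) (p x y : Fin n → ℝ) (r : ℝ)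
    (a w : Fin n → ℝ) :
    g.curvatureForm p x y (r • a) w = r * g.curvatureForm p x y a w := by
  simp only [curvatureForm_eq, fderiv_christoffelFirst, christoffel_smul, ddval_smul, map_smul,
    g.ddval_swap p x (r • a), g.ddval_swap p x a, g.ddval_comm p _ _ y,
    g.ddval_swap p y (r • a), g.ddval_swap p y a, g.ddval_comm p _ _ x,
    ddval_smul_left, smul_eq_mul]
  ring

theorem alternating_two (f : (Fin 2 → ℝ) → (Fin 2 → ℝ) → ℝ)
    (hadd : ∀ a b c, f (a + b) c = f a c + f b c) (hsmul : ∀ (r : ℝ) a c, f (r • a) c = r * f a c)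
    (hskew : ∀ a b, f a b = -f b a) (x y : Fin 2 → ℝ) :
    f x y = (x 0 * y 1 - x 1 * y 0) * f (Pi.single 0 1) (Pi.single 1 1) := by
  have hx : ∀ u : Fin 2 → ℝ, u = u 0 • Pi.single 0 1 + u 1 • Pi.single 1 1 := fun u => by
    funext i; fin_cases i <;> simp
  have h0 : ∀ a, f a a = 0 := fun a => by have := hskew a a; linarith
  have h1 : ∀ u w, f u w = u 0 * f (Pi.single 0 1) w + u 1 * f (Pi.single 1 1) w := fun u w => by
    conv_lhs => rw [hx u]
    rw [hadd, hsmul, hsmul]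
  rw [h1, hskew _ y, hskew _ y, h1 y, h1 y, h0, h0, hskew (Pi.single 1 1)]
  ring

/-- The curvature `K` is the number `⟨R(x,y)y,x⟩`, for every orthonormal pair `x, y`. -/
theorem gaussCurvature_eq (g : SemiRiemannianMetric 2) (p x y : Fin 2 → ℝ)
    (h : g.IsOrthonormalPair p x y) : g.gaussCurvature p = g.curvatureForm p x y y x := by
  obtain ⟨hx, hy, hxy⟩ := h
  have h1 := alternating_two (fun a b => g.curvatureForm p a b y x)
    (fun a b c => g.curvatureForm_add_left p a b c y x)
    (fun r a c => g.curvatureForm_smul_left p r a c y x)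
    (fun a b => g.curvatureForm_skew_left p a b y x) x y
  have h2 := alternating_two
    (fun a b => g.curvatureForm p (Pi.single 0 1) (Pi.single 1 1) a b)
    (fun a b c => g.curvatureForm_add_third p _ _ a b c)
    (fun r a c => g.curvatureForm_smul_third p _ _ r a c)
    (fun a b => g.curvatureForm_skew_right p _ _ a b) y x
  have h3 := g.curvatureForm_skew_right p (Pi.single 0 1) (Pi.single 1 1)
    (Pi.single 0 1) (Pi.single 1 1)
  have hdet : g.val p x x * g.val p y y - g.val p x y ^ 2
      = (x 0 * y 1 - x 1 * y 0) ^ 2 * (g.gram p).det := by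
    have hv : ∀ u v : Fin 2 → ℝ, g.val p u v = u 0 * (v 0 * g.gram p 0 0 + v 1 * g.gram p 0 1)
        + u 1 * (v 0 * g.gram p 1 0 + v 1 * g.gram p 1 1) := fun u v => by
      rw [val_eq_sum_left, Fin.sum_univ_two, apply_eq_sum (g.val p (Pi.single 0 1)) v,
        apply_eq_sum (g.val p (Pi.single 1 1)) v, Fin.sum_univ_two, Fin.sum_univ_two]
      rfl
    have hs : g.gram p 1 0 = g.gram p 0 1 := g.symm p _ _
    rw [hv, hv, hv, Matrix.det_fin_two, hs]; ring
  have hd : (x 0 * y 1 - x 1 * y 0) ^ 2 * |(g.gram p).det| = 1 := by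
    rw [← abs_of_nonneg (sq_nonneg (x 0 * y 1 - x 1 * y 0)), ← abs_mul, ← hdet, hxy]
    simp [abs_mul, hx, hy]
  have hne : |(g.gram p).det| ≠ 0 := abs_ne_zero.mpr (g.det_gram_ne_zero p)
  rw [gaussCurvature, h1, h2, h3, g.curvatureForm_skew_right, div_eq_iff hne]
  linear_combination (-(g.curvatureForm p (Pi.single 0 1) (Pi.single 1 1)
    (Pi.single 0 1) (Pi.single 1 1))) * (-1) * hd

end SemiRiemannianMetric

/-! The proof is a Gauss–Bonnet argument with moving frames. On the plane, g has a global smooth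
orthonormal coframe θ₁, θ₂ that is constant outside a ball (`exists_coframe`). Its connection form
ω, determined by dθ₁ = -ε₁ ω ∧ θ₂ and dθ₂ = ε₂ ω ∧ θ₁, therefore vanishes outside that ball, and the
Gauss equation reads dω = K θ₁ ∧ θ₂ in every signature (`IsCoframe.gaussCurvature_mul`). By Stokes'
theorem ∫ dω = 0. The density of θ₁ ∧ θ₂ has no zeros, hence a constant sign, so dω has a sign as
soon as K has one; then dω = 0 (`curl_eq_zero_of_nonneg`) and K = 0.

Now ω = dτ by the Poincaré lemma. Rotating the coframe by the angle τ (by a Lorentz boost if g is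
indefinite) makes both forms closed, say df₁ and df₂ (`IsCoframe.exists_potentials`), and F = (f₁,
f₂) pulls g₀ back to g. Outside the ball F has constant Jacobian matrix, and since the exterior is
connected, F is affine there. So F is a proper local diffeomorphism for which some point has exactly
one preimage, and such a map is a global diffeomorphism
(`exists_diffeomorph_of_affine_outside_ball`).

The coframe comes from Gram–Schmidt if g is definite. In the Lorentzian case ∂₀ may become null, so
the Gram matrix is diagonalized instead: its eigenvalues have opposite signs and never meet, and the
doubled angle of its eigenvectors is a smooth map from the plane to the circle, which lifts. -/

/-- The `i`-th partial derivative. -/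
noncomputable def partialDeriv (i : Fin 2) (f : (Fin 2 → ℝ) → ℝ) (p : Fin 2 → ℝ) : ℝ :=
  fderiv ℝ f p (Pi.single i 1)

/-! ### Calculus in the plane: partial derivatives and the Poincaré lemma. -/

section PartialDeriv

variable {f h : (Fin 2 → ℝ) → ℝ}

theorem fderiv_eq_partialDeriv (f : (Fin 2 → ℝ) → ℝ) (p x : Fin 2 → ℝ) :
    fderiv ℝ f p x = x 0 * partialDeriv 0 f p + x 1 * partialDeriv 1 f p := by
  have := SemiRiemannianMetric.apply_eq_sum (fderiv ℝ f p : (Fin 2 → ℝ) →ₗ[ℝ] ℝ) x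
  rw [Fin.sum_univ_two] at this
  exact this

theorem ContDiff.partialDeriv (hf : ContDiff ℝ ∞ f) (i : Fin 2) :
    ContDiff ℝ ∞ (partialDeriv i f) :=
  (hf.fderiv_right (m := ∞) (by simp)).clm_apply contDiff_const

theorem ContDiff.smooth_differentiable (hf : ContDiff ℝ ∞ f) : Differentiable ℝ f :=
  hf.differentiable (by simp)

theorem partialDeriv_const (i : Fin 2) (r : ℝ) (p : Fin 2 → ℝ) :
    partialDeriv i (fun _ => r) p = 0 := by
  simp [partialDeriv]

theorem partialDeriv_add (hf : Differentiable ℝ f) (hh : Differentiable ℝ h) (i : Fin 2)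
    (p : Fin 2 → ℝ) :
    partialDeriv i (fun q => f q + h q) p = partialDeriv i f p + partialDeriv i h p := by
  rw [partialDeriv, fderiv_fun_add (hf p) (hh p)]; rfl

theorem partialDeriv_sub (hf : Differentiable ℝ f) (hh : Differentiable ℝ h) (i : Fin 2)
    (p : Fin 2 → ℝ) :
    partialDeriv i (fun q => f q - h q) p = partialDeriv i f p - partialDeriv i h p := by
  rw [partialDeriv, fderiv_fun_sub (hf p) (hh p)]; rfl

theorem partialDeriv_mul (hf : Differentiable ℝ f) (hh : Differentiable ℝ h) (i : Fin 2)
    (p : Fin 2 → ℝ) :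
    partialDeriv i (fun q => f q * h q) p
      = partialDeriv i f p * h p + f p * partialDeriv i h p := by
  rw [partialDeriv, fderiv_fun_mul (hf p) (hh p)]
  simp only [add_apply, smul_apply, smul_eq_mul, partialDeriv]
  ring

theorem partialDeriv_const_mul (hf : Differentiable ℝ f) (r : ℝ) (i : Fin 2) (p : Fin 2 → ℝ) :
    partialDeriv i (fun q => r * f q) p = r * partialDeriv i f p := by
  rw [partialDeriv, fderiv_const_mul (hf p)]; rfl

theorem partialDeriv_comp {s : ℝ → ℝ} {s' : ℝ} {p : Fin 2 → ℝ} (hf : Differentiable ℝ f)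
    (hs : HasDerivAt s s' (f p)) (i : Fin 2) :
    partialDeriv i (fun q => s (f q)) p = s' * partialDeriv i f p := by
  have h : HasFDerivAt (fun q => s (f q)) _ p := hs.comp_hasFDerivAt p (hf p).hasFDerivAt
  rw [partialDeriv, h.fderiv]; rfl

theorem partialDeriv_swap (hf : ContDiff ℝ ∞ f) (i j : Fin 2) (p : Fin 2 → ℝ) :
    partialDeriv i (partialDeriv j f) p = partialDeriv j (partialDeriv i f) p := by
  have hd : Differentiable ℝ (fderiv ℝ f) :=
    (hf.fderiv_right (m := ∞) (by simp)).differentiable (by simp)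
  have h : ∀ i j, partialDeriv i (partialDeriv j f) p
      = fderiv ℝ (fderiv ℝ f) p (Pi.single i 1) (Pi.single j 1) := by
    intro i j
    rw [partialDeriv, show partialDeriv j f = fun q => fderiv ℝ f q (Pi.single j 1) from rfl,
      fderiv_clm_apply (hd p) (by fun_prop)]
    simp
  have hs : IsSymmSndFDerivAt ℝ f p :=
    hf.contDiffAt.isSymmSndFDerivAt
      (by simpa using (WithTop.coe_le_coe.mpr le_top : ((2 : ℕ∞) : WithTop ℕ∞) ≤ ∞))
  rw [h, h, hs]

theorem partialDeriv_eq_zero_of_eventually_const {p : Fin 2 → ℝ} {r : ℝ}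
    (h : ∀ᶠ q in nhds p, f q = r) (i : Fin 2) : partialDeriv i f p = 0 := by
  rw [partialDeriv, Filter.EventuallyEq.fderiv_eq (f₁ := f) (f := fun _ => r) h]; simp

/-- The Poincaré lemma for smooth 1-forms on the plane. -/
theorem exists_potential {u v : (Fin 2 → ℝ) → ℝ} (hu : ContDiff ℝ ∞ u) (hv : ContDiff ℝ ∞ v)
    (huv : ∀ p, partialDeriv 0 v p = partialDeriv 1 u p) :
    ∃ f : (Fin 2 → ℝ) → ℝ, ContDiff ℝ ∞ f ∧
      ∀ p, partialDeriv 0 f p = u p ∧ partialDeriv 1 f p = v p := by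
  let π : Fin 2 → (Fin 2 → ℝ) →L[ℝ] ℝ := fun i => ContinuousLinearMap.proj i
  let α : (Fin 2 → ℝ) → (Fin 2 → ℝ) →L[ℝ] ℝ := fun p => u p • π 0 + v p • π 1
  have hα : ContDiff ℝ ∞ α :=
    (hu.smul contDiff_const).add (hv.smul contDiff_const)
  have hud := hu.smooth_differentiable
  have hvd := hv.smooth_differentiable
  have hαd : ∀ p x y, fderiv ℝ α p x y = fderiv ℝ u p x * y 0 + fderiv ℝ v p x * y 1 := by
    intro p x y
    have h1 : HasFDerivAt α _ p :=
      ((hud p).hasFDerivAt.smul_const (π 0)).add ((hvd p).hasFDerivAt.smul_const (π 1))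
    rw [h1.fderiv]
    simp [π]
  obtain ⟨f, hf⟩ := convex_univ.exists_forall_hasFDerivAt_of_fderiv_symmetric isOpen_univ
    (hα.differentiable (by simp)).differentiableOn (fun p _ x y => by
      rw [hαd, hαd]; simp only [fderiv_eq_partialDeriv]
      rw [huv]; ring)
  have hf' : fderiv ℝ f = α := funext fun p => (hf p trivial).fderiv
  refine ⟨f, ?_, fun p => ?_⟩
  · rw [contDiff_infty_iff_fderiv, hf']
    exact ⟨fun p => (hf p trivial).differentiableAt, hα⟩
  · simp [partialDeriv, hf', α, π]

/-! ### The exterior of a ball, and Stokes' theorem for compact supports. -/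

theorem isOpen_setOf_lt_norm (R : ℝ) : IsOpen {p : Fin 2 → ℝ | R < ‖p‖} :=
  isOpen_lt continuous_const continuous_norm

/-- The norm is the sup norm, so the exterior of the ball is the union of four open half-planes,
each meeting the next one in a quadrant. -/
theorem isPreconnected_setOf_lt_norm {R : ℝ} (hR : 0 ≤ R) :
    IsPreconnected {p : Fin 2 → ℝ | R < ‖p‖} := by
  have hl : ∀ i : Fin 2, IsPreconnected {p : Fin 2 → ℝ | R < p i} := fun i =>
    (convex_halfSpace_gt (f := fun p : Fin 2 → ℝ => p i) ⟨fun _ _ => rfl, fun _ _ => rfl⟩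
      R).isPreconnected
  have hr : ∀ i : Fin 2, IsPreconnected {p : Fin 2 → ℝ | p i < -R} := fun i =>
    (convex_halfSpace_lt (f := fun p : Fin 2 → ℝ => p i) ⟨fun _ _ => rfl, fun _ _ => rfl⟩
      (-R)).isPreconnected
  -- The explicit points are corners lying both in the new half-plane and in the union built so far.
  have h1 := (hl 0).union ![R + 1, R + 1] (by simp) (by simp) (hl 1)
  have h2 := h1.union ![-(R + 1), R + 1] (Or.inr (by simp)) (by simp) (hr 0)
  have h3 := h2.union ![R + 1, -(R + 1)] (Or.inl (Or.inl (by simp))) (by simp) (hr 1)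
  convert h3 using 1
  ext p
  have := (pi_norm_le_iff_of_nonneg (x := p) hR).not
  simp only [not_le, not_forall, Fin.exists_fin_two, Real.norm_eq_abs, lt_abs] at this
  simp only [Set.mem_ofPred_eq, Set.mem_union, this, lt_neg (a := R)]
  tauto

theorem exists_const_outside_ball {R : ℝ} (hR : 0 ≤ R) (hf : Differentiable ℝ f)
    (h0 : ∀ p, R < ‖p‖ → partialDeriv 0 f p = 0 ∧ partialDeriv 1 f p = 0) :
    ∃ r, ∀ p, R < ‖p‖ → f p = r :=
  (isOpen_setOf_lt_norm R).exists_is_const_of_fderiv_eq_zero (isPreconnected_setOf_lt_norm hR)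
    hf.differentiableOn fun p hp => by
      ext x
      simp [fderiv_eq_partialDeriv, h0 p hp]

theorem partialDeriv_eq_zero_outside_ball {R r : ℝ} (h : ∀ p, R < ‖p‖ → f p = r) (i : Fin 2)
    {p : Fin 2 → ℝ} (hp : R < ‖p‖) : partialDeriv i f p = 0 :=
  partialDeriv_eq_zero_of_eventually_const
    (Filter.eventually_of_mem ((isOpen_setOf_lt_norm R).mem_nhds hp) h) i

theorem hasCompactSupport_of_eq_zero_outside_ball {R : ℝ} (h : ∀ p, R < ‖p‖ → f p = 0) :
    HasCompactSupport f :=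
  HasCompactSupport.intro (isCompact_closedBall 0 R) fun p hp => h p (by simpa using hp)

/-- Integration by parts against the constant function 1. -/
theorem integral_partialDeriv_eq_zero (hf : ContDiff ℝ ∞ f) (hc : HasCompactSupport f)
    (i : Fin 2) : ∫ p, partialDeriv i f p = 0 := by
  have hi : MeasureTheory.Integrable (partialDeriv i f) :=
    (hf.partialDeriv i).continuous.integrable_of_hasCompactSupport
      (hc.fderiv_apply (𝕜 := ℝ) (Pi.single i 1))
  have := integral_mul_fderiv_eq_neg_fderiv_mul_of_integrable (𝕜 := ℝ)
    (μ := (MeasureTheory.volume : MeasureTheory.Measure (Fin 2 → ℝ)))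
    (f := fun _ => (1 : ℝ)) (g := f) (v := Pi.single i 1) (by simp)
    (by simpa only [one_mul] using! hi)
    (by simpa using hf.continuous.integrable_of_hasCompactSupport hc)
    (by simp) (fun x _ => hf.smooth_differentiable x)
  simpa [partialDeriv] using this

/-- The exterior derivative of a 1-form with compact support vanishes if it has a sign. -/
theorem curl_eq_zero_of_nonneg {u v : (Fin 2 → ℝ) → ℝ} (hu : ContDiff ℝ ∞ u)
    (hv : ContDiff ℝ ∞ v) (huc : HasCompactSupport u) (hvc : HasCompactSupport v)
    (h : ∀ p, 0 ≤ partialDeriv 0 v p - partialDeriv 1 u p) (p : Fin 2 → ℝ) :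
    partialDeriv 0 v p - partialDeriv 1 u p = 0 := by
  by_contra hne
  have h0 : HasCompactSupport (partialDeriv 0 v) := hvc.fderiv_apply (𝕜 := ℝ) (Pi.single 0 1)
  have h1 : HasCompactSupport (partialDeriv 1 u) := huc.fderiv_apply (𝕜 := ℝ) (Pi.single 1 1)
  have c0 := (hv.partialDeriv 0).continuous
  have c1 := (hu.partialDeriv 1).continuous
  have hpos := (c0.sub c1).integral_pos_of_hasCompactSupport_nonneg_nonzero
    -- A continuous nonnegative function that is not identically zero has positive integral, whereas
    -- both terms of dω integrate to zero.
    (μ := MeasureTheory.volume) (h0.sub h1) (fun q => h q) hne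
  simp only [Pi.sub_apply] at hpos
  rw [MeasureTheory.integral_sub (c0.integrable_of_hasCompactSupport h0)
    (c1.integrable_of_hasCompactSupport h1), integral_partialDeriv_eq_zero hv hvc,
    integral_partialDeriv_eq_zero hu huc, sub_zero] at hpos
  exact lt_irrefl _ hpos

end PartialDeriv

/-! ### From local to global diffeomorphisms. -/

/-- A continuous function without zeros that is positive somewhere is positive. -/
theorem Continuous.pos_of_ne_zero {X : Type*} [TopologicalSpace X] [PreconnectedSpace X]
    {f : X → ℝ} (hf : Continuous f) (h : ∀ x, f x ≠ 0) {x₀ : X} (h0 : 0 < f x₀) (x : X) :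
    0 < f x := by
  by_contra hx
  obtain ⟨y, hy⟩ := mem_range_of_exists_le_of_exists_ge hf ⟨x, not_lt.mp hx⟩ ⟨x₀, h0.le⟩
  exact h y hy

theorem HasStrictFDerivAt.exists_mem_nhds_injOn {E F : Type*} [NormedAddCommGroup E]
    [NormedSpace ℝ E] [CompleteSpace E] [NormedAddCommGroup F] [NormedSpace ℝ F]
    {f : E → F} {f' : E ≃L[ℝ] F} {a : E}
    (hf : HasStrictFDerivAt f (f' : E →L[ℝ] F) a) : ∃ U ∈ nhds a, Set.InjOn f U :=
  ⟨_, (hf.toOpenPartialHomeomorph f).open_source.mem_nhds hf.mem_toOpenPartialHomeomorph_source,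
    (hf.toOpenPartialHomeomorph f).injOn⟩

/-- A proper, open and locally injective map to a connected Hausdorff space is injective if some
point has exactly one preimage. -/
theorem IsProperMap.injective_of_isOpenMap {X Y : Type*} [TopologicalSpace X] [T2Space X]
    [TopologicalSpace Y] [T2Space Y] [PreconnectedSpace Y] {f : X → Y} (hf : IsProperMap f)
    (ho : IsOpenMap f) (hi : ∀ x, ∃ U ∈ nhds x, Set.InjOn f U) {x₀ : X}
    (h0 : ∀ x, f x = f x₀ → x = x₀) : Function.Injective f := by
  -- The pairs of distinct points with equal image. Local injectivity keeps this set away from the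
  -- diagonal, so it is closed.
  let S : Set (X × X) := {z | f z.1 = f z.2 ∧ z.1 ≠ z.2}
  have hS : IsClosed S := by
    rw [← isOpen_compl_iff, isOpen_iff_mem_nhds]
    rintro ⟨x, y⟩ hxy
    by_cases hE : f x = f y
    · have hxy' : x = y := by
        by_contra hne
        exact hxy ⟨hE, hne⟩
      subst hxy'
      obtain ⟨U, hU, hinj⟩ := hi x
      filter_upwards [prod_mem_nhds hU hU] with z hz hzS
      exact hzS.2 (hinj hz.1 hz.2 hzS.1)
    · have : IsOpen {z : X × X | f z.1 ≠ f z.2} :=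
        isOpen_ne_fun (hf.continuous.comp continuous_fst) (hf.continuous.comp continuous_snd)
      filter_upwards [this.mem_nhds hE] with z hz hzS
      exact hz hzS.1
  -- The points with at least two preimages. This set is closed because f × f is proper, and open
  -- because f is open; by connectedness it is empty or everything, and f x₀ is not in it.
  let T : Set Y := {y | ∃ x x', f x = y ∧ f x' = y ∧ x ≠ x'}
  have hT : T = (fun y => (y, y)) ⁻¹' (Prod.map f f '' S) := by
    ext y
    constructor
    · rintro ⟨x, x', h1, h2, h3⟩
      exact ⟨(x, x'), ⟨h1.trans h2.symm, h3⟩, by simp [h1, h2]⟩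
    · rintro ⟨⟨x, x'⟩, ⟨_, h3⟩, h4⟩
      simp only [Prod.map_apply, Prod.mk.injEq] at h4
      exact ⟨x, x', h4.1, h4.2, h3⟩
  have hTc : IsClosed T := by
    rw [hT]
    exact ((hf.prodMap hf).isClosedMap _ hS).preimage (by fun_prop)
  have hTo : IsOpen T := by
    rw [isOpen_iff_mem_nhds]
    rintro y ⟨x, x', h1, h2, h3⟩
    obtain ⟨U, V, hU, hV, hxU, hxV, hd⟩ := t2_separation h3
    have hy1 : f '' U ∈ nhds y := h1 ▸ (ho U hU).mem_nhds ⟨x, hxU, rfl⟩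
    have hy2 : f '' V ∈ nhds y := h2 ▸ (ho V hV).mem_nhds ⟨x', hxV, rfl⟩
    filter_upwards [hy1, hy2]
    rintro z ⟨a, ha, haz⟩ ⟨b, hb, hbz⟩
    exact ⟨a, b, haz, hbz, fun hab => Set.disjoint_left.mp hd ha (hab ▸ hb)⟩
  have hTe : T = ∅ := by
    rcases isClopen_iff.mp ⟨hTc, hTo⟩ with h | h
    · exact h
    · obtain ⟨x, x', h1, h2, h3⟩ : f x₀ ∈ T := h ▸ Set.mem_univ _
      exact absurd ((h0 x h1).trans (h0 x' h2).symm) h3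
  intro x x' hxx
  by_contra hne
  exact Set.eq_empty_iff_forall_notMem.mp hTe (f x) ⟨x, x', rfl, hxx.symm, hne⟩

/-- A smooth local diffeomorphism of a finite-dimensional space that is affine outside some ball
is a global diffeomorphism. -/
theorem exists_diffeomorph_of_affine_outside_ball {E : Type*} [NormedAddCommGroup E]
    [NormedSpace ℝ E] [FiniteDimensional ℝ E] [Nontrivial E] {f : E → E} (hf : ContDiff ℝ ∞ f)
    (hinj : ∀ p x, fderiv ℝ f p x = 0 → x = 0) {R : ℝ} {A : E →L[ℝ] E} {c : E}
    (hA : ∀ p, R < ‖p‖ → f p = A p + c) :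
    ∃ φ : Diffeomorph 𝓘(ℝ, E) 𝓘(ℝ, E) E E ∞, ∀ p, φ p = f p := by
  have hfd : Differentiable ℝ f := hf.differentiable (by simp)
  let e : E → E ≃L[ℝ] E := fun p => (LinearEquiv.ofInjectiveEndo (fderiv ℝ f p : E →ₗ[ℝ] E)
    ((injective_iff_map_eq_zero _).mpr (hinj p))).toContinuousLinearEquiv
  have he : ∀ p, HasStrictFDerivAt f (e p : E →L[ℝ] E) p := fun p =>
    hf.contDiffAt.hasStrictFDerivAt (by simp)
  have ho : IsOpenMap f := isOpenMap_iff_nhds_le.mpr fun p => (he p).map_nhds_eq_of_equiv.ge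
  have hli : ∀ p, ∃ U ∈ nhds p, Set.InjOn f U := fun p => (he p).exists_mem_nhds_injOn
  obtain ⟨p₁, hp₁⟩ := NormedSpace.exists_lt_norm ℝ E R
  -- The linear part A is the derivative of f at a far point, hence injective and proper. As f
  -- agrees with A + c near infinity, f is proper too.
  have hAf : A = fderiv ℝ f p₁ := by
    have : f =ᶠ[nhds p₁] fun p => A p + c :=
      Filter.eventually_of_mem ((isOpen_lt continuous_const continuous_norm).mem_nhds hp₁) hA
    rw [this.fderiv_eq]
    simp
  have hAinj : Function.Injective A :=
    (injective_iff_map_eq_zero _).mpr fun x hx => hinj p₁ x (hAf ▸ hx)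
  have hAt : Filter.Tendsto A (Filter.cocompact E) (Filter.cocompact E) :=
    (LinearMap.isClosedEmbedding_of_injective (f := (A : E →ₗ[ℝ] E))
      (LinearMap.ker_eq_bot.mpr hAinj)).tendsto_cocompact
  have hft : Filter.Tendsto f (Filter.cocompact E) (Filter.cocompact E) := by
    refine Filter.Tendsto.congr' (f₁ := fun p => A p + c) ?_
      ((Homeomorph.addRight c).isClosedEmbedding.tendsto_cocompact.comp hAt)
    rw [← Metric.cobounded_eq_cocompact]
    filter_upwards [tendsto_norm_cobounded_atTop.eventually_gt_atTop R] with p hp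
    exact (hA p hp).symm
  have hpr : IsProperMap f := isProperMap_iff_tendsto_cocompact.mpr ⟨hf.continuous, hft⟩
  have hsurj : Function.Surjective f := by
    rw [← Set.range_eq_univ]
    exact IsClopen.eq_univ ⟨hpr.isClosedMap.isClosed_range, ho.isOpen_range⟩ (Set.range_nonempty f)
  -- A point y outside the bounded image of the ball has preimages only where f is affine and
  -- injective, so exactly one.
  obtain ⟨M, hM⟩ := ((isCompact_closedBall (0 : E) R).image hf.continuous).isBounded.exists_norm_le
  obtain ⟨y, hy⟩ := NormedSpace.exists_lt_norm ℝ E M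
  have hfar : ∀ x, f x = y → R < ‖x‖ := fun x hx => by
    by_contra hxR
    exact absurd (hM y ⟨x, by simpa using hxR, hx⟩) (not_le.mpr hy)
  obtain ⟨x₀, hx₀⟩ := hsurj y
  have hfi : Function.Injective f := by
    refine hpr.injective_of_isOpenMap ho hli (x₀ := x₀) (fun x hx => ?_)
    have h1 := hA x (hfar x (hx.trans hx₀))
    rw [hx, hA x₀ (hfar x₀ hx₀)] at h1
    exact (hAinj (add_right_cancel h1)).symm
  let H : E ≃ₜ E := (Equiv.ofBijective f ⟨hfi, hsurj⟩).toHomeomorphOfContinuousOpen hf.continuous ho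
  have hH : ContDiff ℝ ∞ H.symm :=
    H.contDiff_symm (f₀' := e) (fun p => (he p).hasFDerivAt) hf
  exact ⟨⟨H.toEquiv, hf.contMDiff, hH.contMDiff⟩, fun _ => rfl⟩

/-! ### Orthonormal coframes, the connection form and the Gauss equation. -/

namespace SemiRiemannianMetric

/-- The 1-forms `a dx + b dy` and `c dx + d dy` satisfy
`g = ε₁ (a dx + b dy)² + ε₂ (c dx + d dy)²`. -/
def IsCoframe (g : SemiRiemannianMetric 2) (ε₁ ε₂ : ℝ) (a b c d : (Fin 2 → ℝ) → ℝ) : Prop :=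
  ∀ p x y, g.val p x y = ε₁ * ((a p * x 0 + b p * x 1) * (a p * y 0 + b p * y 1))
    + ε₂ * ((c p * x 0 + d p * x 1) * (c p * y 0 + d p * y 1))

variable {g : SemiRiemannianMetric 2} {ε₁ ε₂ : ℝ} {a b c d u v : (Fin 2 → ℝ) → ℝ}

theorem IsCoframe.det_gram (h : g.IsCoframe ε₁ ε₂ a b c d) (p : Fin 2 → ℝ) :
    (g.gram p).det = ε₁ * ε₂ * (a p * d p - b p * c p) ^ 2 := by
  rw [Matrix.det_fin_two]
  simp only [gram, Matrix.of_apply, h p]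
  simp
  ring

theorem IsCoframe.det_ne_zero (h : g.IsCoframe ε₁ ε₂ a b c d) (p : Fin 2 → ℝ) :
    a p * d p - b p * c p ≠ 0 := by
  intro h0
  apply g.det_gram_ne_zero p
  rw [h.det_gram, h0]
  ring

/-- The components of `∇_u v` in a coframe are determined by the Christoffel symbols of the
first kind. -/
theorem IsCoframe.christoffel_eq (h : g.IsCoframe ε₁ ε₂ a b c d) (p x y : Fin 2 → ℝ)
    (hε₁ : ε₁ ^ 2 = 1) (hε₂ : ε₂ ^ 2 = 1) {s t : ℝ}
    (h0 : g.christoffelFirst p x y (Pi.single 0 1) = ε₁ * (a p * s) + ε₂ * (c p * t))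
    (h1 : g.christoffelFirst p x y (Pi.single 1 1) = ε₁ * (b p * s) + ε₂ * (d p * t)) :
    a p * g.christoffel p x y 0 + b p * g.christoffel p x y 1 = s ∧
      c p * g.christoffel p x y 0 + d p * g.christoffel p x y 1 = t := by
  rw [← val_christoffel, h p] at h0 h1
  simp at h0 h1
  have hd := h.det_ne_zero p
  -- Cramer's rule for the two equations `h0`, `h1`, whose determinant is a d - b c up to sign
  -- factors; these are removed by ε₁² = ε₂² = 1.
  constructor
  · apply mul_left_cancel₀ hd
    linear_combination (ε₁ * d p) * h0 - ε₁ * c p * h1 - (a p * d p - b p * c p) *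
      (a p * g.christoffel p x y 0 + b p * g.christoffel p x y 1 - s) * hε₁
  · apply mul_left_cancel₀ hd
    linear_combination -(ε₂ * b p) * h0 + ε₂ * a p * h1 - (a p * d p - b p * c p) *
      (c p * g.christoffel p x y 0 + d p * g.christoffel p x y 1 - t) * hε₂

theorem dval_single (g : SemiRiemannianMetric 2) (p v w : Fin 2 → ℝ) (i : Fin 2) :
    g.dval p (Pi.single i 1) v w = partialDeriv i (fun q => g.val q v w) p := rfl

theorem partialDeriv_quadratic (ha : Differentiable ℝ a) (hb : Differentiable ℝ b)
    (hc : Differentiable ℝ c) (hd : Differentiable ℝ d) (i : Fin 2) (p : Fin 2 → ℝ) :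
    partialDeriv i (fun q => ε₁ * (a q * b q) + ε₂ * (c q * d q)) p
      = ε₁ * (partialDeriv i a p * b p + a p * partialDeriv i b p)
        + ε₂ * (partialDeriv i c p * d p + c p * partialDeriv i d p) := by
  rw [partialDeriv_add (by fun_prop) (by fun_prop), partialDeriv_const_mul (by fun_prop),
    partialDeriv_const_mul (by fun_prop), partialDeriv_mul ha hb, partialDeriv_mul hc hd]

/-- Cartan's structure equations `dθ₁ = -ε₁ ω ∧ θ₂`, `dθ₂ = ε₂ ω ∧ θ₁` for the coframe
`θ₁ = a dx + b dy`, `θ₂ = c dx + d dy` and the connection form `ω = u dx + v dy`. -/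
def StructureEquations (ε₁ ε₂ : ℝ) (a b c d u v : (Fin 2 → ℝ) → ℝ) : Prop :=
  ∀ p, partialDeriv 0 b p - partialDeriv 1 a p = -ε₁ * (u p * d p - v p * c p) ∧
    partialDeriv 0 d p - partialDeriv 1 c p = ε₂ * (u p * b p - v p * a p)

/-- The right-hand side is ⟨∇ᵢ∂ⱼ, ∂ₖ⟩ for the connection with θ₁(∇ᵢ∂ⱼ) = ∂ᵢ(θ₁)ⱼ + ε₁ ωᵢ (θ₂)ⱼ and
θ₂(∇ᵢ∂ⱼ) = ∂ᵢ(θ₂)ⱼ - ε₂ ωᵢ (θ₁)ⱼ. It is metric by the form of these formulas and torsion-free by the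
structure equations, so it is the Levi-Civita connection. -/
theorem IsCoframe.christoffelFirst_single (h : g.IsCoframe ε₁ ε₂ a b c d)
    (hω : StructureEquations ε₁ ε₂ a b c d u v) (hε₁ : ε₁ ^ 2 = 1) (hε₂ : ε₂ ^ 2 = 1)
    (ha : Differentiable ℝ a) (hb : Differentiable ℝ b) (hc : Differentiable ℝ c)
    (hd : Differentiable ℝ d) (p : Fin 2 → ℝ) (i j k : Fin 2) :
    g.christoffelFirst p (Pi.single i 1) (Pi.single j 1) (Pi.single k 1)
      = ε₁ * (![a, b] k p * (partialDeriv i (![a, b] j) p + ε₁ * (![u, v] i p * ![c, d] j p)))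
        + ε₂ * (![c, d] k p *
          (partialDeriv i (![c, d] j) p - ε₂ * (![u, v] i p * ![a, b] j p))) := by
  obtain ⟨h1, h2⟩ := hω p
  have hv : ∀ i j : Fin 2, (fun q => g.val q (Pi.single i 1) (Pi.single j 1))
      = fun q => ε₁ * (![a, b] i q * ![a, b] j q) + ε₂ * (![c, d] i q * ![c, d] j q) := by
    intro i j
    funext q
    rw [h q]
    fin_cases i <;> fin_cases j <;> simp
  have hab : ∀ i, Differentiable ℝ (![a, b] i) := by simp [Fin.forall_fin_two, ha, hb]
  have hcd : ∀ i, Differentiable ℝ (![c, d] i) := by simp [Fin.forall_fin_two, hc, hd]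
  simp only [christoffelFirst, dval_single, hv, partialDeriv_quadratic (hab _) (hab _) (hcd _)
    (hcd _)]
  -- Eliminating ∂₀b and ∂₀d by the structure equations leaves polynomial identities modulo ε₁² =
  -- ε₂² = 1, one for each index triple.
  have e1 : partialDeriv 0 b p = partialDeriv 1 a p - ε₁ * (u p * d p - v p * c p) := by
    linear_combination h1
  have e2 : partialDeriv 0 d p = partialDeriv 1 c p + ε₂ * (u p * b p - v p * a p) := by
    linear_combination h2
  fin_cases i <;> fin_cases j <;> fin_cases k <;> simp [e1, e2] <;> ring_nf <;>
    simp only [hε₁, hε₂] <;> ring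

/-- The Gauss equation: the curvature is `dω / θ₁ ∧ θ₂`. -/
theorem IsCoframe.curvatureForm_eq (h : g.IsCoframe ε₁ ε₂ a b c d)
    (hω : StructureEquations ε₁ ε₂ a b c d u v) (hε₁ : ε₁ ^ 2 = 1) (hε₂ : ε₂ ^ 2 = 1)
    (ha : ContDiff ℝ ∞ a) (hb : ContDiff ℝ ∞ b) (hc : ContDiff ℝ ∞ c) (hd : ContDiff ℝ ∞ d)
    (hu : ContDiff ℝ ∞ u) (hv : ContDiff ℝ ∞ v) (p : Fin 2 → ℝ) :
    g.curvatureForm p (Pi.single 0 1) (Pi.single 1 1) (Pi.single 1 1) (Pi.single 0 1)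
      = (partialDeriv 0 v p - partialDeriv 1 u p) * (a p * d p - b p * c p) := by
  have ha' := ha.smooth_differentiable
  have hb' := hb.smooth_differentiable
  have hc' := hc.smooth_differentiable
  have hd' := hd.smooth_differentiable
  have hu' := hu.smooth_differentiable
  have hv' := hv.smooth_differentiable
  have H := fun p => h.christoffelFirst_single hω hε₁ hε₂ ha' hb' hc' hd' p
  -- The coframe components of ∇ᵢ∂ⱼ give the products ⟨Γ, Γ⟩ in the curvature directly, without
  -- inverting the Gram matrix.
  have hP := fun i j => h.christoffel_eq p (Pi.single i 1) (Pi.single j 1) hε₁ hε₂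
    (by simpa using H p i j 0) (by simpa using H p i j 1)
  have hD : ∀ (i j : Fin 2) {e f w : (Fin 2 → ℝ) → ℝ}, ContDiff ℝ ∞ e → ContDiff ℝ ∞ f →
      Differentiable ℝ w →
      partialDeriv i (fun q => ε₁ * (a q * (partialDeriv j e q + ε₁ * (w q * f q)))
        + ε₂ * (c q * (partialDeriv j f q - ε₂ * (w q * e q)))) p
      = ε₁ * (partialDeriv i a p * (partialDeriv j e p + ε₁ * (w p * f p))
          + a p * (partialDeriv i (partialDeriv j e) p
            + ε₁ * (partialDeriv i w p * f p + w p * partialDeriv i f p)))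
        + ε₂ * (partialDeriv i c p * (partialDeriv j f p - ε₂ * (w p * e p))
          + c p * (partialDeriv i (partialDeriv j f) p
            - ε₂ * (partialDeriv i w p * e p + w p * partialDeriv i e p))) := by
    intro i j e f w he hf hw
    have he1 := (he.partialDeriv j).smooth_differentiable
    have hf1 := (hf.partialDeriv j).smooth_differentiable
    have he' := he.smooth_differentiable
    have hf' := hf.smooth_differentiable
    rw [partialDeriv_quadratic (by fun_prop) (by fun_prop) (by fun_prop) (by fun_prop),
      partialDeriv_add (by fun_prop) (by fun_prop), partialDeriv_sub (by fun_prop) (by fun_prop),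
      partialDeriv_const_mul (by fun_prop), partialDeriv_const_mul (by fun_prop),
      partialDeriv_mul (by fun_prop) (by fun_prop), partialDeriv_mul (by fun_prop) (by fun_prop)]
  rw [SemiRiemannianMetric.curvatureForm_eq, h p, h p, (hP 0 0).1, (hP 0 0).2, (hP 1 0).1,
    (hP 1 0).2, (hP 0 1).1, (hP 0 1).2, (hP 1 1).1, (hP 1 1).2]
  simp only [H]
  have e1 := hD 0 1 hb hd hv'
  have e2 := hD 1 0 hb hd hu'
  rw [partialDeriv] at e1 e2
  simp only [Matrix.cons_val_zero, Matrix.cons_val_one]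
  -- Once the mixed second derivatives cancel, only dω · (a d - b c) survives modulo ε₁² = ε₂² = 1.
  rw [e1, e2, partialDeriv_swap hb 1 0, partialDeriv_swap hd 1 0]
  linear_combination (partialDeriv 0 v p - partialDeriv 1 u p) * (a p * d p) * hε₁
    - (partialDeriv 0 v p - partialDeriv 1 u p) * (b p * c p) * hε₂
    + (v p * (a p * partialDeriv 0 d p + c p * partialDeriv 0 b p)
      - u p * (a p * partialDeriv 1 d p + c p * partialDeriv 1 b p)) * (hε₁ - hε₂)

/-- Since |ε₁ ε₂| = 1, the denominator |det g| in K is (a d - b c)² whatever the signature, and one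
factor cancels against the Gauss equation. -/
theorem IsCoframe.gaussCurvature_mul (h : g.IsCoframe ε₁ ε₂ a b c d)
    (hω : StructureEquations ε₁ ε₂ a b c d u v) (hε₁ : ε₁ ^ 2 = 1) (hε₂ : ε₂ ^ 2 = 1)
    (ha : ContDiff ℝ ∞ a) (hb : ContDiff ℝ ∞ b) (hc : ContDiff ℝ ∞ c) (hd : ContDiff ℝ ∞ d)
    (hu : ContDiff ℝ ∞ u) (hv : ContDiff ℝ ∞ v) (p : Fin 2 → ℝ) :
    g.gaussCurvature p * (a p * d p - b p * c p) = partialDeriv 0 v p - partialDeriv 1 u p := by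
  have hε : |ε₁ * ε₂| = 1 := by
    rw [← sq_eq_sq₀ (abs_nonneg _) zero_le_one, sq_abs, mul_pow, hε₁, hε₂]
    norm_num
  have hne := h.det_ne_zero p
  rw [gaussCurvature, h.curvatureForm_eq hω hε₁ hε₂ ha hb hc hd hu hv, h.det_gram, abs_mul, hε,
    one_mul, abs_of_nonneg (sq_nonneg _)]
  field_simp

/-- The connection form of a smooth coframe exists. -/
theorem IsCoframe.exists_structureEquations (h : g.IsCoframe ε₁ ε₂ a b c d)
    (hε₁ : ε₁ ^ 2 = 1) (hε₂ : ε₂ ^ 2 = 1)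
    (ha : ContDiff ℝ ∞ a) (hb : ContDiff ℝ ∞ b) (hc : ContDiff ℝ ∞ c) (hd : ContDiff ℝ ∞ d) :
    ∃ u v, ContDiff ℝ ∞ u ∧ ContDiff ℝ ∞ v ∧ StructureEquations ε₁ ε₂ a b c d u v ∧
      ∀ p, partialDeriv 0 b p = 0 → partialDeriv 1 a p = 0 → partialDeriv 0 d p = 0 →
        partialDeriv 1 c p = 0 → u p = 0 ∧ v p = 0 := by
  have hΔ : ContDiff ℝ ∞ fun p => a p * d p - b p * c p := (ha.mul hd).sub (hb.mul hc)
  have h1 : ContDiff ℝ ∞ fun p => partialDeriv 0 b p - partialDeriv 1 a p :=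
    (hb.partialDeriv 0).sub (ha.partialDeriv 1)
  have h2 : ContDiff ℝ ∞ fun p => partialDeriv 0 d p - partialDeriv 1 c p :=
    (hd.partialDeriv 0).sub (hc.partialDeriv 1)
  -- Writing dθᵢ = δᵢ dx ∧ dy and Δ = a d - b c, the ansatz ω = r θ₁ + s θ₂ turns the structure
  -- equations into δ₁ = -ε₁ r Δ and δ₂ = -ε₂ s Δ. Hence ω = -(ε₁ δ₁ θ₁ + ε₂ δ₂ θ₂) / Δ, whose two
  -- components are the quotients below.
  have hsmooth : ∀ {r s : (Fin 2 → ℝ) → ℝ}, ContDiff ℝ ∞ r → ContDiff ℝ ∞ s →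
      ContDiff ℝ ∞ fun p => -(ε₁ * ((partialDeriv 0 b p - partialDeriv 1 a p) * r p)
        + ε₂ * ((partialDeriv 0 d p - partialDeriv 1 c p) * s p)) / (a p * d p - b p * c p) :=
    fun hr hs => (((contDiff_const.mul (h1.mul hr)).add (contDiff_const.mul (h2.mul hs))).neg).div
      hΔ h.det_ne_zero
  refine ⟨_, _, hsmooth ha hc, hsmooth hb hd, fun p => ?_, fun p h1 h2 h3 h4 => ?_⟩
  · have hne := h.det_ne_zero p
    have hu := fun r s : ℝ => div_mul_cancel₀ (-(ε₁ * ((partialDeriv 0 b p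
      - partialDeriv 1 a p) * r) + ε₂ * ((partialDeriv 0 d p - partialDeriv 1 c p) * s))) hne
    constructor
    · apply mul_right_cancel₀ hne
      linear_combination ε₁ * d p * hu (a p) (c p) - ε₁ * c p * hu (b p) (d p)
        - (partialDeriv 0 b p - partialDeriv 1 a p) * (a p * d p - b p * c p) * hε₁
    · apply mul_right_cancel₀ hne
      linear_combination ε₂ * a p * hu (b p) (d p) - ε₂ * b p * hu (a p) (c p)
        - (partialDeriv 0 d p - partialDeriv 1 c p) * (a p * d p - b p * c p) * hε₂
  · simp [h1, h2, h3, h4]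

end SemiRiemannianMetric

/-! ### Global orthonormal coframes. -/

/-- A smooth map from the plane to the unit circle lifts to a smooth angle function. -/
theorem exists_angle {x y : (Fin 2 → ℝ) → ℝ} (hx : ContDiff ℝ ∞ x) (hy : ContDiff ℝ ∞ y)
    (hxy : ∀ p, x p ^ 2 + y p ^ 2 = 1) :
    ∃ χ : (Fin 2 → ℝ) → ℝ, ContDiff ℝ ∞ χ ∧
      (∀ p, Real.cos (χ p) = x p ∧ Real.sin (χ p) = y p) ∧
      ∀ i p, partialDeriv i χ p = x p * partialDeriv i y p - y p * partialDeriv i x p := by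
  have hx' := hx.smooth_differentiable
  have hy' := hy.smooth_differentiable
  have hx1 := fun i => (hx.partialDeriv i).smooth_differentiable
  have hy1 := fun i => (hy.partialDeriv i).smooth_differentiable
  have horth : ∀ i p, x p * partialDeriv i x p + y p * partialDeriv i y p = 0 := by
    intro i p
    have h1 : (fun q => x q * x q + y q * y q) = fun _ => (1 : ℝ) := by
      funext q
      rw [← hxy q]
      ring
    have h2 := congrArg (fun f => partialDeriv i f p) h1
    simp only [partialDeriv_const] at h2
    rw [partialDeriv_add (by fun_prop) (by fun_prop), partialDeriv_mul hx' hx',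
      partialDeriv_mul hy' hy'] at h2
    linarith
  have hsm : ∀ i, ContDiff ℝ ∞ fun p => x p * partialDeriv i y p - y p * partialDeriv i x p :=
    fun i => (hx.mul (hy.partialDeriv i)).sub (hy.mul (hx.partialDeriv i))
  -- The angle form x dy - y dx has differential 2 dx ∧ dy, which vanishes because a map into the
  -- circle has rank at most one.
  obtain ⟨f, hf, hf1⟩ := exists_potential (hsm 0) (hsm 1) (fun p => by
    rw [partialDeriv_sub (by fun_prop) (by fun_prop), partialDeriv_sub (by fun_prop) (by fun_prop),
      partialDeriv_mul hx' (hy1 1), partialDeriv_mul hy' (hx1 1), partialDeriv_mul hx' (hy1 0),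
      partialDeriv_mul hy' (hx1 0), partialDeriv_swap hx 1 0, partialDeriv_swap hy 1 0]
    have h0 := horth 0 p
    have h1 := horth 1 p
    have hJ : partialDeriv 0 x p * partialDeriv 1 y p - partialDeriv 0 y p * partialDeriv 1 x p
        = 0 := by
      linear_combination (-(partialDeriv 0 x p * partialDeriv 1 y p
        - partialDeriv 0 y p * partialDeriv 1 x p)) * hxy p
        + (x p * partialDeriv 1 y p - y p * partialDeriv 1 x p) * h0
        - (x p * partialDeriv 0 y p - y p * partialDeriv 0 x p) * h1
    linear_combination 2 * hJ)
  have hf2 : ∀ i p, partialDeriv i f p = x p * partialDeriv i y p - y p * partialDeriv i x p :=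
    fun i p => by
      fin_cases i
      · exact (hf1 p).1
      · exact (hf1 p).2
  have hfd := hf.smooth_differentiable
  have hx2 : ∀ i p, partialDeriv i x p = -y p * partialDeriv i f p := fun i p => by
    rw [hf2]
    linear_combination (-partialDeriv i x p) * hxy p + x p * horth i p
  have hy2 : ∀ i p, partialDeriv i y p = x p * partialDeriv i f p := fun i p => by
    rw [hf2]
    linear_combination (-partialDeriv i y p) * hxy p + y p * horth i p
  have hcos : ∀ i p, partialDeriv i (fun q => Real.cos (f q)) p
      = -Real.sin (f p) * partialDeriv i f p :=
    fun i p => partialDeriv_comp hfd (Real.hasDerivAt_cos _) i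
  have hsin : ∀ i p, partialDeriv i (fun q => Real.sin (f q)) p
      = Real.cos (f p) * partialDeriv i f p :=
    fun i p => partialDeriv_comp hfd (Real.hasDerivAt_sin _) i
  have hcd : Differentiable ℝ fun q => Real.cos (f q) := hfd.cos
  have hsd : Differentiable ℝ fun q => Real.sin (f q) := hfd.sin
  have hconst : ∀ {h : (Fin 2 → ℝ) → ℝ}, Differentiable ℝ h →
      (∀ i p, partialDeriv i h p = 0) → ∀ p, h p = h 0 := fun hd h0 p =>
    is_const_of_fderiv_eq_zero (𝕜 := ℝ) hd (fun q => by
      ext z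
      simp [fderiv_eq_partialDeriv, h0]) p 0
  -- The functions in `hm` and `hn` are the real and imaginary parts of (x + i y) e^(-i f), which is
  -- constant of modulus 1. Adding its argument α to f gives the required lift.
  have hm := hconst (h := fun q => x q * Real.cos (f q) + y q * Real.sin (f q)) (by fun_prop)
    (fun i p => by
      rw [partialDeriv_add (by fun_prop) (by fun_prop), partialDeriv_mul hx' hcd,
        partialDeriv_mul hy' hsd, hcos, hsin, hx2, hy2]
      ring)
  have hn := hconst (h := fun q => y q * Real.cos (f q) - x q * Real.sin (f q)) (by fun_prop)
    (fun i p => by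
      rw [partialDeriv_sub (by fun_prop) (by fun_prop), partialDeriv_mul hy' hcd,
        partialDeriv_mul hx' hsd, hcos, hsin, hx2, hy2]
      ring)
  set m := x 0 * Real.cos (f 0) + y 0 * Real.sin (f 0)
  set n := y 0 * Real.cos (f 0) - x 0 * Real.sin (f 0)
  have hz : ‖(⟨m, n⟩ : ℂ)‖ = 1 := by
    have : m ^ 2 + n ^ 2 = 1 := by
      rw [← hxy 0]
      simp only [m, n]
      linear_combination (x 0 ^ 2 + y 0 ^ 2) * Real.sin_sq_add_cos_sq (f 0)
    rw [← sq_eq_sq₀ (norm_nonneg _) zero_le_one, ← Complex.normSq_eq_norm_sq, Complex.normSq_mk]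
    linarith
  have hα1 := Complex.norm_mul_cos_arg (⟨m, n⟩ : ℂ)
  have hα2 := Complex.norm_mul_sin_arg (⟨m, n⟩ : ℂ)
  rw [hz, one_mul] at hα1 hα2
  set α := Complex.arg ⟨m, n⟩
  refine ⟨fun p => f p + α, hf.add contDiff_const, fun p => ?_, fun i p => ?_⟩
  · rw [Real.cos_add, Real.sin_add, hα1, hα2]
    simp only
    rw [← hm p, ← hn p]
    constructor
    · linear_combination x p * Real.sin_sq_add_cos_sq (f p)
    · linear_combination y p * Real.sin_sq_add_cos_sq (f p)
  · rw [partialDeriv_add hfd (by fun_prop), partialDeriv_const, hf2, add_zero]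

/-- Cholesky factorization of a definite quadratic form depending smoothly on parameters. -/
theorem exists_coframe_definite {E F H : (Fin 2 → ℝ) → ℝ} (hE : ContDiff ℝ ∞ E)
    (hF : ContDiff ℝ ∞ F) (hH : ContDiff ℝ ∞ H) (hdet : ∀ p, E p * H p - F p ^ 2 ≠ 0) {R s : ℝ}
    (hs : s ^ 2 = 1) (hout : ∀ p, R < ‖p‖ → E p = s ∧ F p = 0 ∧ H p = s) :
    ∃ a b c d : (Fin 2 → ℝ) → ℝ,
      ContDiff ℝ ∞ a ∧ ContDiff ℝ ∞ b ∧ ContDiff ℝ ∞ c ∧ ContDiff ℝ ∞ d ∧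
      (∀ p, E p = s * a p ^ 2 + s * c p ^ 2 ∧ F p = s * (a p * b p) + s * (c p * d p) ∧
        H p = s * b p ^ 2 + s * d p ^ 2) ∧
      ∃ a₀ b₀ c₀ d₀, ∀ p, R < ‖p‖ → a p = a₀ ∧ b p = b₀ ∧ c p = c₀ ∧ d p = d₀ := by
  obtain ⟨p₁, hp₁⟩ := NormedSpace.exists_lt_norm ℝ (Fin 2 → ℝ) R
  obtain ⟨e1, e2, e3⟩ := hout p₁ hp₁
  have hD : ContDiff ℝ ∞ fun p => E p * H p - F p ^ 2 := (hE.mul hH).sub (hF.pow 2)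
  have hDpos : ∀ p, 0 < E p * H p - F p ^ 2 :=
    hD.continuous.pos_of_ne_zero hdet (x₀ := p₁) (by rw [e1, e2, e3]; nlinarith)
  have hs0 : s ≠ 0 := by rintro rfl; norm_num at hs
  -- If E vanished, the determinant would be -F² ≤ 0, but it is positive everywhere.
  have hE0 : ∀ p, s * E p ≠ 0 := fun p h0 => by
    have h1 : E p = 0 := (mul_eq_zero.mp h0).resolve_left hs0
    have := hDpos p
    rw [h1] at this
    nlinarith [sq_nonneg (F p)]
  have hsE : ContDiff ℝ ∞ fun p => s * E p := contDiff_const.mul hE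
  have hEpos : ∀ p, 0 < s * E p :=
    hsE.continuous.pos_of_ne_zero hE0 (x₀ := p₁) (by rw [e1]; nlinarith)
  have hq : ∀ p, 0 < (E p * H p - F p ^ 2) / (s * E p) := fun p => div_pos (hDpos p) (hEpos p)
  have ha : ContDiff ℝ ∞ fun p => √(s * E p) := hsE.sqrt hE0
  refine ⟨fun p => √(s * E p), fun p => s * F p / √(s * E p), fun _ => 0,
    fun p => √((E p * H p - F p ^ 2) / (s * E p)), ha,
    (contDiff_const.mul hF).div ha (fun p => (Real.sqrt_pos.mpr (hEpos p)).ne'), contDiff_const,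
    (hD.div hsE hE0).sqrt (fun p => (hq p).ne'), fun p => ?_,
    √(s * s), s * 0 / √(s * s), 0, √((s * s - 0 ^ 2) / (s * s)), fun p hp => ?_⟩
  · have h1 := Real.sqrt_pos.mpr (hEpos p)
    have h2 := Real.sq_sqrt (hEpos p).le
    have h3 := Real.sq_sqrt (hq p).le
    have hEp : E p ≠ 0 := right_ne_zero_of_mul (hE0 p)
    refine ⟨?_, ?_, ?_⟩
    · rw [h2]
      linear_combination (-E p) * hs
    · field_simp
      linear_combination (-F p) * hs
    · simp only
      rw [h3, div_pow, h2]
      field_simp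
      linear_combination (-F p ^ 2) * hs
  · obtain ⟨e1, e2, e3⟩ := hout p hp
    simp only [e1, e2, e3, and_self]

/-- Spectral decomposition of a Lorentzian quadratic form depending smoothly on parameters. -/
theorem exists_coframe_lorentzian {E F H : (Fin 2 → ℝ) → ℝ} (hE : ContDiff ℝ ∞ E)
    (hF : ContDiff ℝ ∞ F) (hH : ContDiff ℝ ∞ H) (hdet : ∀ p, E p * H p - F p ^ 2 ≠ 0) {R : ℝ}
    (hR : 0 ≤ R) (hout : ∀ p, R < ‖p‖ → E p = -1 ∧ F p = 0 ∧ H p = 1) :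
    ∃ a b c d : (Fin 2 → ℝ) → ℝ,
      ContDiff ℝ ∞ a ∧ ContDiff ℝ ∞ b ∧ ContDiff ℝ ∞ c ∧ ContDiff ℝ ∞ d ∧
      (∀ p, E p = -1 * a p ^ 2 + 1 * c p ^ 2 ∧ F p = -1 * (a p * b p) + 1 * (c p * d p) ∧
        H p = -1 * b p ^ 2 + 1 * d p ^ 2) ∧
      ∃ a₀ b₀ c₀ d₀, ∀ p, R < ‖p‖ → a p = a₀ ∧ b p = b₀ ∧ c p = c₀ ∧ d p = d₀ := by
  obtain ⟨p₁, hp₁⟩ := NormedSpace.exists_lt_norm ℝ (Fin 2 → ℝ) R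
  obtain ⟨e1, e2, e3⟩ := hout p₁ hp₁
  have hD : ContDiff ℝ ∞ fun p => F p ^ 2 - E p * H p := (hF.pow 2).sub (hE.mul hH)
  have hDpos : ∀ p, 0 < F p ^ 2 - E p * H p :=
    hD.continuous.pos_of_ne_zero (fun p h => hdet p (by linarith)) (x₀ := p₁)
      (by rw [e1, e2, e3]; norm_num)
  have hQ : ContDiff ℝ ∞ fun p => (E p - H p) ^ 2 + (2 * F p) ^ 2 :=
    ((hE.sub hH).pow 2).add ((contDiff_const.mul hF).pow 2)
  -- The difference of the two sides is 4 (F² - E H) > 0. So r = √((E - H)² + 4 F²) is smooth and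
  -- the eigenvalues (E + H ± r) / 2 have opposite signs.
  have hQpos : ∀ p, (E p + H p) ^ 2 < (E p - H p) ^ 2 + (2 * F p) ^ 2 := fun p => by
    nlinarith [hDpos p]
  have hQ0 : ∀ p, 0 < (E p - H p) ^ 2 + (2 * F p) ^ 2 := fun p =>
    (sq_nonneg _).trans_lt (hQpos p)
  obtain ⟨r, hr⟩ : ∃ r : (Fin 2 → ℝ) → ℝ, r = fun p => √((E p - H p) ^ 2 + (2 * F p) ^ 2) :=
    ⟨_, rfl⟩
  have hrs : ContDiff ℝ ∞ r := hr ▸ hQ.sqrt fun p => (hQ0 p).ne'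
  have hr0 : ∀ p, 0 < r p := fun p => hr ▸ Real.sqrt_pos.mpr (hQ0 p)
  have hr2 : ∀ p, r p ^ 2 = (E p - H p) ^ 2 + (2 * F p) ^ 2 := fun p => by
    rw [hr]
    exact Real.sq_sqrt (hQ0 p).le
  have hlt : ∀ p, |E p + H p| < r p := fun p =>
    abs_lt_of_sq_lt_sq (by rw [hr2]; exact hQpos p) (hr0 p).le
  -- χ is twice the angle of the eigenvector for the positive eigenvalue. The eigenvector itself is
  -- only defined up to sign, so the doubled angle is lifted and then halved.
  obtain ⟨χ, hχ, hcs, hχ'⟩ := exists_angle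
    (x := fun p => (E p - H p) / r p) (y := fun p => 2 * F p / r p) ((hE.sub hH).div hrs fun p => (hr0 p).ne')
    ((contDiff_const (c := (2 : ℝ)).mul hF).div hrs fun p => (hr0 p).ne') (fun p => by
      have := (hr0 p).ne'
      field_simp
      rw [hr2]
      ring)
  have hrout : ∀ p, R < ‖p‖ → r p = √((-1 - 1) ^ 2 + (2 * 0) ^ 2) := fun p hp => by
    obtain ⟨e1, e2, e3⟩ := hout p hp
    rw [hr]
    simp only [e1, e2, e3]
  -- The lift stays constant outside the ball: its derivative vanishes there and the exterior is
  -- connected.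
  obtain ⟨χ₀, hχ₀⟩ := exists_const_outside_ball hR hχ.smooth_differentiable (fun p hp => by
    rw [hχ', hχ']
    have h1 : ∀ q, R < ‖q‖ → (E q - H q) / r q = (-1 - 1) / √((-1 - 1) ^ 2 + (2 * 0) ^ 2) :=
      fun q hq => by
        obtain ⟨e1, e2, e3⟩ := hout q hq
        rw [hrout q hq, e1, e3]
    have h2 : ∀ q, R < ‖q‖ → 2 * F q / r q = 2 * 0 / √((-1 - 1) ^ 2 + (2 * 0) ^ 2) :=
      fun q hq => by
        obtain ⟨e1, e2, e3⟩ := hout q hq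
        rw [hrout q hq, e2]
    simp only [partialDeriv_eq_zero_outside_ball h1 _ hp,
      partialDeriv_eq_zero_outside_ball h2 _ hp, mul_zero, sub_zero, and_self])
  have hψ : ContDiff ℝ ∞ fun p => χ p / 2 := hχ.div_const 2
  have hl1 : ∀ p, 0 < (r p - (E p + H p)) / 2 := fun p => by
    linarith [(abs_lt.mp (hlt p)).2]
  have hl2 : ∀ p, 0 < (r p + (E p + H p)) / 2 := fun p => by
    linarith [(abs_lt.mp (hlt p)).1]
  have hs1 : ContDiff ℝ ∞ fun p => √((r p - (E p + H p)) / 2) :=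
    ((hrs.sub (hE.add hH)).div_const 2).sqrt fun p => (hl1 p).ne'
  have hs2 : ContDiff ℝ ∞ fun p => √((r p + (E p + H p)) / 2) :=
    ((hrs.add (hE.add hH)).div_const 2).sqrt fun p => (hl2 p).ne'
  have hconst : ∀ f : ℝ → ℝ → ℝ → ℝ → ℝ, ∃ z, ∀ p, R < ‖p‖ → f (r p) (E p) (H p) (χ p) = z :=
    fun f => ⟨f (√((-1 - 1) ^ 2 + (2 * 0) ^ 2)) (-1) 1 χ₀, fun p hp => by
      obtain ⟨e1, e2, e3⟩ := hout p hp
      rw [hrout p hp, e1, e3, hχ₀ p hp]⟩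
  obtain ⟨a₀, ha₀⟩ := hconst fun r E H χ => -(√((r - (E + H)) / 2) * Real.sin (χ / 2))
  obtain ⟨b₀, hb₀⟩ := hconst fun r E H χ => √((r - (E + H)) / 2) * Real.cos (χ / 2)
  obtain ⟨c₀, hc₀⟩ := hconst fun r E H χ => √((r + (E + H)) / 2) * Real.cos (χ / 2)
  obtain ⟨d₀, hd₀⟩ := hconst fun r E H χ => √((r + (E + H)) / 2) * Real.sin (χ / 2)
  refine ⟨_, _, _, _, (hs1.mul hψ.sin).neg, hs1.mul hψ.cos, hs2.mul hψ.cos, hs2.mul hψ.sin,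
    fun p => ?_, a₀, b₀, c₀, d₀, fun p hp => ⟨ha₀ p hp, hb₀ p hp, hc₀ p hp, hd₀ p hp⟩⟩
  have h1 := Real.sq_sqrt (hl1 p).le
  have h2 := Real.sq_sqrt (hl2 p).le
  have hc := (hcs p).1
  have hs := (hcs p).2
  have hχ2 : χ p = 2 * (χ p / 2) := by ring
  rw [hχ2, Real.cos_two_mul, eq_div_iff (hr0 p).ne'] at hc
  rw [hχ2, Real.sin_two_mul, eq_div_iff (hr0 p).ne'] at hs
  have hone := Real.sin_sq_add_cos_sq (χ p / 2)
  generalize Real.cos (χ p / 2) = C at *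
  generalize Real.sin (χ p / 2) = S at *
  generalize √((r p - (E p + H p)) / 2) = A at *
  generalize √((r p + (E p + H p)) / 2) = B at *
  have hS : S ^ 2 = 1 - C ^ 2 := by linarith
  refine ⟨?_, ?_, ?_⟩
  · rw [neg_sq, mul_pow, mul_pow, h1, h2, hS]
    linear_combination (-1 / 2) * hc
  · linear_combination (-1 / 2) * hs - C * S * h1 - C * S * h2
  · rw [mul_pow, mul_pow, h1, h2, hS]
    linear_combination (1 / 2) * hc

/-- The sign of the `i`-th coordinate in the flat form of index `k`. -/
noncomputable def flatSign (k i : ℕ) : ℝ := if i < k then -1 else 1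

theorem flatSign_sq (k i : ℕ) : flatSign k i ^ 2 = 1 := by
  unfold flatSign
  split_ifs <;> norm_num

/-- Cosine and sine, or their hyperbolic analogues, according to the sign `ε`. -/
theorem exists_trig {ε : ℝ} (hε : ε ^ 2 = 1) :
    ∃ C S : ℝ → ℝ, ContDiff ℝ ∞ C ∧ ContDiff ℝ ∞ S ∧ (∀ t, HasDerivAt C (-ε * S t) t) ∧
      (∀ t, HasDerivAt S (C t) t) ∧ ∀ t, C t ^ 2 + ε * S t ^ 2 = 1 := by
  rcases eq_or_eq_neg_of_sq_eq_sq ε 1 (hε.trans (one_pow 2).symm) with rfl | rfl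
  · exact ⟨Real.cos, Real.sin, Real.contDiff_cos, Real.contDiff_sin,
      fun t => by simpa using Real.hasDerivAt_cos t, Real.hasDerivAt_sin,
      fun t => by rw [one_mul, Real.cos_sq_add_sin_sq]⟩
  · exact ⟨Real.cosh, Real.sinh, Real.contDiff_cosh, Real.contDiff_sinh,
      fun t => by simpa using Real.hasDerivAt_cosh t, Real.hasDerivAt_sinh,
      fun t => by linarith [Real.cosh_sq_sub_sinh_sq t]⟩

namespace SemiRiemannianMetric

theorem flat_val_two (k : ℕ) (p x y : Fin 2 → ℝ) :
    (flat 2 k).val p x y = flatSign k 0 * (x 0 * y 0) + flatSign k 1 * (x 1 * y 1) := by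
  change flatForm 2 k x y = _
  rw [flatForm_apply, Fin.sum_univ_two]
  rfl

/-- A metric on the plane that is standard outside a ball has a smooth orthonormal coframe that is
constant outside that ball. -/
theorem exists_coframe (g : SemiRiemannianMetric 2) {k : ℕ} (hk : k ≤ 2) {R : ℝ} (hR : 0 ≤ R)
    (hg : ∀ p, R < ‖p‖ → g.val p = (flat 2 k).val p) :
    ∃ a b c d : (Fin 2 → ℝ) → ℝ,
      ContDiff ℝ ∞ a ∧ ContDiff ℝ ∞ b ∧ ContDiff ℝ ∞ c ∧ ContDiff ℝ ∞ d ∧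
      g.IsCoframe (flatSign k 0) (flatSign k 1) a b c d ∧
      ∃ a₀ b₀ c₀ d₀, ∀ p, R < ‖p‖ → a p = a₀ ∧ b p = b₀ ∧ c p = c₀ ∧ d p = d₀ := by
  have hE := g.contDiff (Pi.single 0 1) (Pi.single 0 1)
  have hF := g.contDiff (Pi.single 0 1) (Pi.single 1 1)
  have hH := g.contDiff (Pi.single 1 1) (Pi.single 1 1)
  have hdet : ∀ p, g.val p (Pi.single 0 1) (Pi.single 0 1) * g.val p (Pi.single 1 1) (Pi.single 1 1)
      - g.val p (Pi.single 0 1) (Pi.single 1 1) ^ 2 ≠ 0 := fun p => by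
    have := g.det_gram_ne_zero p
    rw [Matrix.det_fin_two] at this
    simp only [gram, Matrix.of_apply, g.symm p (Pi.single 1 1) (Pi.single 0 1)] at this
    rwa [sq]
  have hout : ∀ p, R < ‖p‖ → g.val p (Pi.single 0 1) (Pi.single 0 1) = flatSign k 0 ∧
      g.val p (Pi.single 0 1) (Pi.single 1 1) = 0 ∧
      g.val p (Pi.single 1 1) (Pi.single 1 1) = flatSign k 1 := fun p hp => by
    simp [hg p hp, flat_val_two]
  have key : ∃ a b c d : (Fin 2 → ℝ) → ℝ,
      ContDiff ℝ ∞ a ∧ ContDiff ℝ ∞ b ∧ ContDiff ℝ ∞ c ∧ ContDiff ℝ ∞ d ∧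
      (∀ p, g.val p (Pi.single 0 1) (Pi.single 0 1)
          = flatSign k 0 * a p ^ 2 + flatSign k 1 * c p ^ 2 ∧
        g.val p (Pi.single 0 1) (Pi.single 1 1)
          = flatSign k 0 * (a p * b p) + flatSign k 1 * (c p * d p) ∧
        g.val p (Pi.single 1 1) (Pi.single 1 1)
          = flatSign k 0 * b p ^ 2 + flatSign k 1 * d p ^ 2) ∧
      ∃ a₀ b₀ c₀ d₀, ∀ p, R < ‖p‖ → a p = a₀ ∧ b p = b₀ ∧ c p = c₀ ∧ d p = d₀ := by
    -- Among k ≤ 2 only k = 1 is indefinite; otherwise the two signs agree.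
    by_cases h1 : k = 1
    · subst h1
      have s0 : flatSign 1 0 = -1 := by simp [flatSign]
      have s1 : flatSign 1 1 = 1 := by simp [flatSign]
      rw [s0, s1] at hout ⊢
      exact exists_coframe_lorentzian hE hF hH hdet hR hout
    · have hs : flatSign k 1 = flatSign k 0 := by
        unfold flatSign
        congr 1
        apply propext
        omega
      rw [hs] at hout ⊢
      exact exists_coframe_definite hE hF hH hdet (flatSign_sq k 0) hout
  obtain ⟨a, b, c, d, ha, hb, hc, hd, h, hconst⟩ := key
  refine ⟨a, b, c, d, ha, hb, hc, hd, fun p x y => ?_, hconst⟩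
  obtain ⟨h1, h2, h3⟩ := h p
  rw [val_eq_sum_left, Fin.sum_univ_two, apply_eq_sum (g.val p (Pi.single 0 1)) y,
    apply_eq_sum (g.val p (Pi.single 1 1)) y, Fin.sum_univ_two, Fin.sum_univ_two,
    g.symm p (Pi.single 1 1) (Pi.single 0 1), h1, h2, h3]
  ring

/-! ### Flat coframes and the isometry. -/

variable {g : SemiRiemannianMetric 2} {ε₁ ε₂ : ℝ} {a b c d u v : (Fin 2 → ℝ) → ℝ}

/-- If the connection form is closed, the coframe can be rotated into a closed one, which is
constant outside a ball if the original coframe is constant and the connection form vanishes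
there. -/
theorem IsCoframe.exists_potentials (h : g.IsCoframe ε₁ ε₂ a b c d)
    (hω : StructureEquations ε₁ ε₂ a b c d u v) (hε₁ : ε₁ ^ 2 = 1) (hε₂ : ε₂ ^ 2 = 1)
    (ha : ContDiff ℝ ∞ a) (hb : ContDiff ℝ ∞ b) (hc : ContDiff ℝ ∞ c) (hd : ContDiff ℝ ∞ d)
    (hu : ContDiff ℝ ∞ u) (hv : ContDiff ℝ ∞ v)
    (hclosed : ∀ p, partialDeriv 0 v p = partialDeriv 1 u p) {R : ℝ} (hR : 0 ≤ R)
    {a₀ b₀ c₀ d₀ : ℝ} (hout : ∀ p, R < ‖p‖ → a p = a₀ ∧ b p = b₀ ∧ c p = c₀ ∧ d p = d₀)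
    (huv : ∀ p, R < ‖p‖ → u p = 0 ∧ v p = 0) :
    ∃ f₁ f₂ : (Fin 2 → ℝ) → ℝ, ContDiff ℝ ∞ f₁ ∧ ContDiff ℝ ∞ f₂ ∧
      g.IsCoframe ε₁ ε₂ (partialDeriv 0 f₁) (partialDeriv 1 f₁) (partialDeriv 0 f₂)
        (partialDeriv 1 f₂) ∧
      ∃ r : Fin 2 → Fin 2 → ℝ, ∀ i p, R < ‖p‖ →
        partialDeriv i f₁ p = r 0 i ∧ partialDeriv i f₂ p = r 1 i := by
  obtain ⟨τ, hτ, hτ'⟩ := exists_potential hu hv hclosed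
  obtain ⟨τ₀, hτ₀⟩ := exists_const_outside_ball hR hτ.smooth_differentiable fun p hp => by
    rw [(hτ' p).1, (hτ' p).2]
    exact huv p hp
  -- The group preserving ε₁ X² + ε₂ Y² consists of rotations or boosts according to the sign of ε₁
  -- ε₂.
  obtain ⟨C, S, hC, hS, hC', hS', hCS⟩ := exists_trig (ε := ε₁ * ε₂) (by
    rw [mul_pow, hε₁, hε₂, one_mul])
  have ha' := ha.smooth_differentiable
  have hb' := hb.smooth_differentiable
  have hc' := hc.smooth_differentiable
  have hd' := hd.smooth_differentiable
  have hτd := hτ.smooth_differentiable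
  have hCd₀ : Differentiable ℝ C := hC.differentiable (by simp)
  have hSd₀ : Differentiable ℝ S := hS.differentiable (by simp)
  have hCτ : ContDiff ℝ ∞ fun p => C (τ p) := hC.comp hτ
  have hSτ : ContDiff ℝ ∞ fun p => S (τ p) := hS.comp hτ
  have hCd := hCτ.smooth_differentiable
  have hSd := hSτ.smooth_differentiable
  have hCp : ∀ i p, partialDeriv i (fun q => C (τ q)) p
      = -(ε₁ * ε₂) * S (τ p) * partialDeriv i τ p :=
    fun i p => partialDeriv_comp hτd (hC' _) i
  have hSp : ∀ i p, partialDeriv i (fun q => S (τ q)) p = C (τ p) * partialDeriv i τ p :=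
    fun i p => partialDeriv_comp hτd (hS' _) i
  have hsm1 : ∀ {e f : (Fin 2 → ℝ) → ℝ}, ContDiff ℝ ∞ e → ContDiff ℝ ∞ f →
      ContDiff ℝ ∞ fun p => C (τ p) * e p + ε₁ * (S (τ p) * f p) := fun he hf =>
    (hCτ.mul he).add (contDiff_const.mul (hSτ.mul hf))
  have hsm2 : ∀ {e f : (Fin 2 → ℝ) → ℝ}, ContDiff ℝ ∞ e → ContDiff ℝ ∞ f →
      ContDiff ℝ ∞ fun p => C (τ p) * f p - ε₂ * (S (τ p) * e p) := fun he hf =>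
    (hCτ.mul hf).sub (contDiff_const.mul (hSτ.mul he))
  -- In d(C θ₁ + ε₁ S θ₂) the terms from dC and dS cancel those from the structure equations,
  -- because dτ = ω.
  obtain ⟨f₁, hf₁, hf₁'⟩ := exists_potential (hsm1 ha hc) (hsm1 hb hd) (fun p => by
    obtain ⟨h1, h2⟩ := hω p
    rw [partialDeriv_add (by fun_prop) (by fun_prop), partialDeriv_add (by fun_prop) (by fun_prop),
      partialDeriv_const_mul (by fun_prop), partialDeriv_const_mul (by fun_prop),
      partialDeriv_mul hCd hb', partialDeriv_mul hSd hd', partialDeriv_mul hCd ha',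
      partialDeriv_mul hSd hc']
    simp only [hCp, hSp, (hτ' p).1, (hτ' p).2]
    linear_combination C (τ p) * h1 + ε₁ * S (τ p) * h2)
  obtain ⟨f₂, hf₂, hf₂'⟩ := exists_potential (hsm2 ha hc) (hsm2 hb hd) (fun p => by
    obtain ⟨h1, h2⟩ := hω p
    rw [partialDeriv_sub (by fun_prop) (by fun_prop), partialDeriv_sub (by fun_prop) (by fun_prop),
      partialDeriv_const_mul (by fun_prop), partialDeriv_const_mul (by fun_prop),
      partialDeriv_mul hCd hd', partialDeriv_mul hSd hb', partialDeriv_mul hCd hc',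
      partialDeriv_mul hSd ha']
    simp only [hCp, hSp, (hτ' p).1, (hτ' p).2]
    linear_combination C (τ p) * h2 - ε₂ * S (τ p) * h1)
  refine ⟨f₁, f₂, hf₁, hf₂, fun p x y => ?_,
    ![![C τ₀ * a₀ + ε₁ * (S τ₀ * c₀), C τ₀ * b₀ + ε₁ * (S τ₀ * d₀)],
      ![C τ₀ * c₀ - ε₂ * (S τ₀ * a₀), C τ₀ * d₀ - ε₂ * (S τ₀ * b₀)]], fun i p hp => ?_⟩
  · rw [(hf₁' p).1, (hf₁' p).2, (hf₂' p).1, (hf₂' p).2, h p]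
    linear_combination
      (-(ε₁ * ((a p * x 0 + b p * x 1) * (a p * y 0 + b p * y 1))
        + ε₂ * ((c p * x 0 + d p * x 1) * (c p * y 0 + d p * y 1)))) * hCS (τ p)
      + (S (τ p) ^ 2 * (ε₂ * ((a p * x 0 + b p * x 1) * (a p * y 0 + b p * y 1))
          - ε₁ * ((c p * x 0 + d p * x 1) * (c p * y 0 + d p * y 1)))
        - C (τ p) * S (τ p) * ((a p * x 0 + b p * x 1) * (c p * y 0 + d p * y 1)
          + (c p * x 0 + d p * x 1) * (a p * y 0 + b p * y 1))) * (hε₁ - hε₂)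
  · obtain ⟨h1, h2, h3, h4⟩ := hout p hp
    have hf1 := hf₁' p
    have hf2 := hf₂' p
    rw [hτ₀ p hp, h1, h2, h3, h4] at hf1 hf2
    fin_cases i
    · exact ⟨hf1.1, hf2.1⟩
    · exact ⟨hf1.2, hf2.2⟩

/-- The coframe identity says that F = (f₁, f₂) pulls g₀ back to g. Nondegeneracy of g then makes F
an immersion, and the constant Jacobian on the connected exterior makes F affine there. -/
theorem isIsometricTo_flat_of_potentials {k : ℕ} {f₁ f₂ : (Fin 2 → ℝ) → ℝ}
    (hf₁ : ContDiff ℝ ∞ f₁) (hf₂ : ContDiff ℝ ∞ f₂)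
    (h : g.IsCoframe (flatSign k 0) (flatSign k 1) (partialDeriv 0 f₁) (partialDeriv 1 f₁)
      (partialDeriv 0 f₂) (partialDeriv 1 f₂)) {R : ℝ} (hR : 0 ≤ R) {r : Fin 2 → Fin 2 → ℝ}
    (hr : ∀ i p, R < ‖p‖ → partialDeriv i f₁ p = r 0 i ∧ partialDeriv i f₂ p = r 1 i) :
    g.IsIsometricTo (flat 2 k) := by
  have hf₁d := hf₁.smooth_differentiable
  have hf₂d := hf₂.smooth_differentiable
  let F : (Fin 2 → ℝ) → Fin 2 → ℝ := fun p => ![f₁ p, f₂ p]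
  have hF : ContDiff ℝ ∞ F := contDiff_pi.mpr fun i => by
    fin_cases i
    · exact hf₁
    · exact hf₂
  have hFd : Differentiable ℝ F := hF.differentiable (by simp)
  have hF' : ∀ p x i, fderiv ℝ F p x i = fderiv ℝ (fun q => F q i) p x := fun p x i => by
    rw [fderiv_pi fun i => differentiable_pi.mp hFd i p]
    rfl
  have hF0 : ∀ p x, fderiv ℝ F p x 0 = partialDeriv 0 f₁ p * x 0 + partialDeriv 1 f₁ p * x 1 :=
    fun p x => by
      rw [hF', mul_comm, mul_comm (partialDeriv 1 f₁ p)]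
      exact fderiv_eq_partialDeriv f₁ p x
  have hF1 : ∀ p x, fderiv ℝ F p x 1 = partialDeriv 0 f₂ p * x 0 + partialDeriv 1 f₂ p * x 1 :=
    fun p x => by
      rw [hF', mul_comm, mul_comm (partialDeriv 1 f₂ p)]
      exact fderiv_eq_partialDeriv f₂ p x
  have hiso : ∀ p x y, (flat 2 k).val (F p) (fderiv ℝ F p x) (fderiv ℝ F p y) = g.val p x y :=
    fun p x y => by rw [flat_val_two, hF0, hF0, hF1, hF1, h p]
  have hinj : ∀ p x, fderiv ℝ F p x = 0 → x = 0 := fun p x hx =>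
    g.nondegenerate p x fun y => by rw [← hiso, hx]; simp
  let A : (Fin 2 → ℝ) →L[ℝ] Fin 2 → ℝ := (Matrix.toLin' (Matrix.of r)).toContinuousLinearMap
  have hA : ∀ (x : Fin 2 → ℝ) i, A x i = r i 0 * x 0 + r i 1 * x 1 := fun x i => by
    simp [A, Matrix.mulVec, dotProduct, Fin.sum_univ_two]
  obtain ⟨t, ht⟩ := (isOpen_setOf_lt_norm R).exists_is_const_of_fderiv_eq_zero (𝕜 := ℝ)
    (f := fun p => F p - A p) (isPreconnected_setOf_lt_norm hR) (by fun_prop) (fun p hp => by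
      rw [fderiv_fun_sub (hFd p) A.differentiableAt, A.fderiv]
      ext x i
      simp only [sub_apply, Pi.sub_apply, hA]
      fin_cases i
      · simp [hF0, (hr _ p hp).1]
      · simp [hF1, (hr _ p hp).2])
  obtain ⟨φ, hφ⟩ := exists_diffeomorph_of_affine_outside_ball hF hinj (A := A) (c := t)
    fun p hp => by rw [← ht p hp]; abel
  refine ⟨φ, fun p x y => ?_⟩
  rw [show (φ : (Fin 2 → ℝ) → Fin 2 → ℝ) = F from funext hφ]
  exact hiso p x y

end SemiRiemannianMetric

/-! ### The rigidity theorem. -/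

theorem mainTheorem11 (k : ℕ) (hk : k ≤ 2) (g : SemiRiemannianMetric 2)
    (C : Set (Fin 2 → ℝ)) (hC : IsCompact C)
    (hg : ∀ p, p ∉ C → g.val p = (SemiRiemannianMetric.flat 2 k).val p)
    (hK : (∀ p, 0 ≤ g.gaussCurvature p) ∨ (∀ p, g.gaussCurvature p ≤ 0)) :
    (∀ p, g.gaussCurvature p = 0) ∧ g.IsIsometricTo (SemiRiemannianMetric.flat 2 k) := by
  -- The complement of C need not be connected, so C is enlarged to a ball.
  obtain ⟨R, hR, hCR⟩ : ∃ R : ℝ, 0 ≤ R ∧ ∀ p ∈ C, ‖p‖ ≤ R := by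
    obtain ⟨R, hR⟩ := hC.isBounded.exists_norm_le
    exact ⟨max R 0, le_max_right _ _, fun p hp => (hR p hp).trans (le_max_left _ _)⟩
  obtain ⟨a, b, c, d, ha, hb, hc, hd, h, a₀, b₀, c₀, d₀, hout⟩ :=
    g.exists_coframe hk hR fun p hp => hg p fun hpC => (hCR p hpC).not_gt hp
  have hε₁ := flatSign_sq k 0
  have hε₂ := flatSign_sq k 1
  obtain ⟨u, v, hu, hv, hω, huv⟩ := h.exists_structureEquations hε₁ hε₂ ha hb hc hd
  have huv0 : ∀ p, R < ‖p‖ → u p = 0 ∧ v p = 0 := fun p hp =>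
    huv p (partialDeriv_eq_zero_outside_ball (fun q hq => (hout q hq).2.1) 0 hp)
      (partialDeriv_eq_zero_outside_ball (fun q hq => (hout q hq).1) 1 hp)
      (partialDeriv_eq_zero_outside_ball (fun q hq => (hout q hq).2.2.2) 0 hp)
      (partialDeriv_eq_zero_outside_ball (fun q hq => (hout q hq).2.2.1) 1 hp)
  have hKmul := h.gaussCurvature_mul hω hε₁ hε₂ ha hb hc hd hu hv
  have huc := hasCompactSupport_of_eq_zero_outside_ball fun p hp => (huv0 p hp).1
  have hvc := hasCompactSupport_of_eq_zero_outside_ball fun p hp => (huv0 p hp).2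
  have hΔ : Continuous fun p => a p * d p - b p * c p :=
    ((ha.mul hd).sub (hb.mul hc)).continuous
  have hΔsign : (∀ p, 0 ≤ a p * d p - b p * c p) ∨ ∀ p, a p * d p - b p * c p ≤ 0 := by
    by_cases hpos : ∃ p, 0 < a p * d p - b p * c p
    · obtain ⟨p, hp⟩ := hpos
      exact Or.inl fun q => (hΔ.pos_of_ne_zero h.det_ne_zero hp q).le
    · exact Or.inr fun q => not_lt.mp fun hq => hpos ⟨q, hq⟩
  have hclosed : ∀ p, partialDeriv 0 v p - partialDeriv 1 u p = 0 := by
    have hsign : (∀ p, 0 ≤ partialDeriv 0 v p - partialDeriv 1 u p) ∨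
        ∀ p, partialDeriv 0 v p - partialDeriv 1 u p ≤ 0 := by
      simp only [← hKmul]
      rcases hK with hK | hK <;> rcases hΔsign with hs | hs
      · exact Or.inl fun p => mul_nonneg (hK p) (hs p)
      · exact Or.inr fun p => mul_nonpos_of_nonneg_of_nonpos (hK p) (hs p)
      · exact Or.inr fun p => mul_nonpos_of_nonpos_of_nonneg (hK p) (hs p)
      · exact Or.inl fun p => mul_nonneg_of_nonpos_of_nonpos (hK p) (hs p)
    rcases hsign with hs | hs
    · exact curl_eq_zero_of_nonneg hu hv huc hvc hs
    -- If dω ≤ 0, the argument is applied to -ω.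
    · have hneg : ∀ {f : (Fin 2 → ℝ) → ℝ}, Differentiable ℝ f → ∀ i p,
          partialDeriv i (fun q => -1 * f q) p = -partialDeriv i f p := fun hf i p => by
        rw [partialDeriv_const_mul hf, neg_one_mul]
      intro p
      have := curl_eq_zero_of_nonneg (contDiff_const.mul hu) (contDiff_const.mul hv)
        (huc.mul_left (f := fun _ => -1)) (hvc.mul_left (f := fun _ => -1)) (fun q => by
          rw [hneg hv.smooth_differentiable, hneg hu.smooth_differentiable]
          linarith [hs q]) p
      rw [hneg hv.smooth_differentiable, hneg hu.smooth_differentiable] at this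
      linarith
  refine ⟨fun p => ?_, ?_⟩
  · have := hKmul p
    rw [hclosed p] at this
    exact (mul_eq_zero.mp this).resolve_right (h.det_ne_zero p)
  · obtain ⟨f₁, f₂, hf₁, hf₂, hf, r, hr⟩ := h.exists_potentials hω hε₁ hε₂ ha hb hc hd hu hv
      (fun p => sub_eq_zero.mp (hclosed p)) hR hout huv0
    exact SemiRiemannianMetric.isIsometricTo_flat_of_potentials hf₁ hf₂ hf hR hr
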